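/- Let $SU(2)$ be the group of unit quaternions, with Lie algebra $su(2)$ the imaginary quaternions and inner product $\{v,w\}=-\mathrm{Re}(vw)$. Let $T=\mathbb R/\mathbb Z\times\mathbb R/\mathbb Z$ be the oriented torus, let $\mu,\lambda\in\pi_1(T)$ be the classes of the two coordinate circles, and let $\chi(T)=\mathrm{Hom}(\pi_1(T),SU(2))/\text{conjugation}$ be its $SU(2)$ character variety, with the quotient topology. The formal tangent space of $\chi(T)$ at the class of $\varphi$ is $H^1(\pi_1(T);su(2)_{\mathrm{ad}\varphi})$, where the velocity at time $0$ of a smooth path $\varphi_s$ with $\varphi_0=\varphi$ is the class of the cocycle $\gamma\mapsto \tfrac{d}{ds}\big|_{s=0}\varphi_s(\gamma)\,\varphi(\gamma)^{-1}$; it carries the form $\omega_T$ given by the cup product, the pairing $\{\ ,\ \}$ and evaluation on the fundamental class $[T]$. Let $\chi(T)^*$ be the set of regular points, that is, of points having a neighbourhood on which the dimension of the formal tangent space is constant; its smooth functions are those that pull back to smooth functions on $\mathrm{Hom}(\pi_1(T),SU(2))\subset SU(2)^2$. Let $D_\mu,D_\lambda:T\to T$ be the Dehn twists about $\mu$ and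 $\lambda$, supported away from the base point, which induce on $\pi_1(T)$ the automorphisms $(\mu\mapsto\mu,\ \lambda\mapsto\mu\lambda)$ and $(\mu\mapsto\mu\lambda^{-1},\ \lambda\mapsto\lambda)$, and let $D_\mu^*,D_\lambda^*:\chi(T)\to\chi(T)$ be the maps induced by precomposition. Let $\mathbb T=U(1)\times U(1)$, on which $SL(2,\mathbb Z)$ acts by $\begin{pmatrix}p&r\\q&s\end{pmatrix}\cdot(e^{ix},e^{iy})=(e^{i(px+ry)},e^{i(qx+sy)})$. Let $\iota(z,w)=(z^{-1},w^{-1})$, let $\mathbb T^*$ be the complement of the four fixed points of $\iota$, and let $\mathbb P=\mathbb T/\iota$ and $\mathbb P^*=\mathbb T^*/\iota$, with the induced action of $PSL(2,\mathbb Z)=SL(2,\mathbb Z)/\{\pm1\}$ on $\mathbb P$. Then: (1) There is a unique action of $PSL(2,\mathbb Z)$ on $\chi(T)$ by homeomorphisms for which the class of $\begin{pmatrix}1&0\\1&1\end{pmatrix}$ acts as $D_\mu^*$ and the class of $\begin{pmatrix}1&-1\\0&1\end{pmatrix}$ acts as $D_\lambda^*$. It is faithful, and its image in $\mathrm{Homeo}(\chi(T))$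 is the subgroup generated by $D_\mu^*$ and $D_\lambda^*$. The action is symplectic: every element restricts to a symplectomorphism of $(\chi(T)^*,\omega_T)$, and at every representation $\varphi$ the maps $[z]\mapsto[z\circ D_\mu]$ and $[z]\mapsto[z\circ D_\lambda]$ between formal tangent spaces preserve $\omega_T$. (2) For each $(e^{ix},e^{iy})\in\mathbb T$ there is a unique homomorphism $\rho(e^{ix},e^{iy}):\pi_1(T)\to SU(2)$ with $\mu\mapsto e^{ix}$ and $\lambda\mapsto e^{iy}$, and $\rho$ descends to a $PSL(2,\mathbb Z)$-equivariant homeomorphism $\mathbb P\to\chi(T)$. (3) For some constant $c\neq0$, this homeomorphism restricts to a ($PSL(2,\mathbb Z)$-equivariant) symplectomorphism $(\mathbb P^*,c\,dx\wedge dy)\to(\chi(T)^*,\omega_T)$. -/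

import Mathlib

open scoped Quaternion ContDiff Topology

noncomputable section

namespace Pillow

/-! ### The group SU(2) and its Lie algebra -/

/-- `SU(2)`, as the group of unit quaternions. -/
abbrev SU2 : Type := unitary ℍ[ℝ]

/-- The Lie algebra `su(2)`: the purely imaginary quaternions. -/
def su2 : Submodule ℝ ℍ[ℝ] where
  carrier := {v | v.re = 0}
  add_mem' := by
    intro a b ha hb
    change a.re = 0 at ha
    change b.re = 0 at hb
    change (a + b).re = 0
    simp [ha, hb]
  zero_mem' := by simp
  smul_mem' := by
    intro c v hv
    change v.re = 0 at hv
    change (c • v).re = 0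
    simp [hv]

theorem conj_mem_su2 (g : SU2) (v : su2) : (g : ℍ[ℝ]) * v * star (g : ℍ[ℝ]) ∈ su2 := by
  have hv : (v : ℍ[ℝ]).re = 0 := v.2
  change ((g : ℍ[ℝ]) * v * star (g : ℍ[ℝ])).re = 0
  simp [hv]
  ring

/-- The adjoint representation `Ad g v = g v g⁻¹`. -/
def Ad : Representation ℝ SU2 su2 where
  toFun g :=
    { toFun := fun v => ⟨(g : ℍ[ℝ]) * v * star (g : ℍ[ℝ]), conj_mem_su2 g v⟩
      map_add' := fun v w => by
        apply Subtype.ext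
        simp [mul_add, add_mul]
      map_smul' := fun c v => by
        apply Subtype.ext
        simp }
  map_one' := by
    apply LinearMap.ext
    intro v
    apply Subtype.ext
    simp
  map_mul' g h := by
    apply LinearMap.ext
    intro v
    apply Subtype.ext
    simp [mul_assoc]

/-- The invariant inner product `{v, w} = -(1/2) Tr (v w) = -Re (v w)` on `su(2)`. -/
def pairing : su2 →ₗ[ℝ] su2 →ₗ[ℝ] ℝ :=
  LinearMap.mk₂ ℝ (fun v w => -((v : ℍ[ℝ]) * (w : ℍ[ℝ])).re)
    (fun v v' w => by simp [add_mul]; ring)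
    (fun c v w => by simp; ring)
    (fun v w w' => by simp [mul_add]; ring)
    (fun c v w => by simp; ring)

theorem pairing_apply (v w : su2) : pairing v w = -((v : ℍ[ℝ]) * (w : ℍ[ℝ])).re := rfl

theorem pairing_Ad (g : SU2) (v w : su2) : pairing (Ad g v) (Ad g w) = pairing v w := by
  have hg : star (g : ℍ[ℝ]) * (g : ℍ[ℝ]) = 1 := g.2.1
  have hc : ∀ a b : ℍ[ℝ], (a * b).re = (b * a).re := by
    intro a b
    simp
    ring
  have h : ((Ad g v : su2) : ℍ[ℝ]) * (Ad g w : su2)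
      = (g : ℍ[ℝ]) * ((v : ℍ[ℝ]) * w * star (g : ℍ[ℝ])) := by
    change ((g : ℍ[ℝ]) * v * star (g : ℍ[ℝ])) * ((g : ℍ[ℝ]) * w * star (g : ℍ[ℝ])) = _
    calc _ = (g : ℍ[ℝ]) * v * (star (g : ℍ[ℝ]) * (g : ℍ[ℝ])) * w * star (g : ℍ[ℝ]) := by
          simp only [mul_assoc]
      _ = _ := by rw [hg]; simp only [mul_assoc, one_mul]
  rw [pairing_apply, pairing_apply, h, hc, mul_assoc, hg, mul_one]

/-! ### Character varieties -/

section CharacterVariety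

variable (Γ : Type) [Group Γ]

/-- The representation space `Hom(Γ, SU(2))`. -/
def RepSpace : Type := Γ →* SU2

instance : FunLike (RepSpace Γ) Γ SU2 := inferInstanceAs (FunLike (Γ →* SU2) Γ SU2)

instance : MonoidHomClass (RepSpace Γ) Γ SU2 :=
  inferInstanceAs (MonoidHomClass (Γ →* SU2) Γ SU2)

/-- The topology of pointwise convergence on `Hom(Γ, SU(2))`, i.e. the subspace topology of
`SU(2)^g` for any choice of `g` generators of `Γ`. -/
instance : TopologicalSpace (RepSpace Γ) :=
  TopologicalSpace.induced (fun φ => (φ : Γ → SU2)) inferInstance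

/-- The orbit relation of the conjugation action of `SU(2)`. -/
def conjSetoid : Setoid (RepSpace Γ) where
  r φ ψ := ∃ g : SU2, ∀ γ, ψ γ = g * φ γ * g⁻¹
  iseqv :=
    { refl := fun φ => ⟨1, fun γ => by simp⟩
      symm := by
        rintro φ ψ ⟨g, h⟩
        exact ⟨g⁻¹, fun γ => by rw [h]; group⟩
      trans := by
        rintro φ ψ θ ⟨g, h⟩ ⟨k, h'⟩
        exact ⟨k * g, fun γ => by rw [h', h]; group⟩ }

/-- The `SU(2)` character variety `χ(Γ) = Hom(Γ, SU(2)) / conjugation`. -/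
def CharVar : Type := Quotient (conjSetoid Γ)

/-- The quotient topology. -/
instance : TopologicalSpace (CharVar Γ) :=
  inferInstanceAs (TopologicalSpace (Quotient (conjSetoid Γ)))

variable {Γ}

/-- The orbit map `p : Hom(Γ, SU(2)) → χ(Γ)`. -/
def orbit (φ : RepSpace Γ) : CharVar Γ := Quotient.mk (conjSetoid Γ) φ

/-- Precomposition of a representation with an endomorphism of `Γ`. -/
def RepSpace.precomp (θ : Γ →* Γ) (φ : RepSpace Γ) : RepSpace Γ := MonoidHom.comp φ θ

/-- The self-map of `χ(Γ)` induced by precomposition with an endomorphism of `Γ`. -/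
def pullback (θ : Γ →* Γ) : CharVar Γ → CharVar Γ :=
  Quotient.map (RepSpace.precomp θ) (by
    rintro φ ψ ⟨g, h⟩
    exact ⟨g, fun γ => h (θ γ)⟩)

/-- The representation `ad φ` of `Γ` on `su(2)`. -/
abbrev adRep (φ : RepSpace Γ) : Rep ℝ Γ := Rep.of (MonoidHom.comp Ad (φ : Γ →* SU2))

/-- The `1`-cocycles of `Γ` with coefficients in `su(2)_{ad φ}`. -/
abbrev Z1 (φ : RepSpace Γ) : Submodule ℝ (Γ → su2) := groupCohomology.cocycles₁ (adRep φ)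

/-- The formal tangent space `H¹(Γ; su(2)_{ad φ})` of `χ(Γ)` at the class of `φ`. -/
abbrev H1 (φ : RepSpace Γ) : Type := groupCohomology.H1 (adRep φ)

/-- The cohomology class of a `1`-cocycle. -/
def cls (φ : RepSpace Γ) : Z1 φ →ₗ[ℝ] H1 φ := (groupCohomology.H1π (adRep φ)).hom

theorem cls_surjective (φ : RepSpace Γ) : Function.Surjective (cls φ) := by
  intro h
  induction h using groupCohomology.H1_induction_on with
  | h x => exact ⟨x, rfl⟩

/-- A class is zero exactly when the cocycle is `γ ↦ Ad (φ γ) a - a` for some `a`. -/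
theorem cls_eq_zero_iff (φ : RepSpace Γ) (z : Z1 φ) :
    cls φ z = 0 ↔ ∃ a : su2, ∀ γ, z.1 γ = Ad (φ γ) a - a := by
  refine (groupCohomology.H1π_eq_zero_iff (A := adRep φ) z).trans ?_
  constructor
  · rintro ⟨a, ha⟩
    exact ⟨a, fun γ => (congrFun ha γ).symm⟩
  · rintro ⟨a, ha⟩
    exact ⟨a, funext fun γ => (ha γ).symm⟩

variable (Γ)

/-- The top stratum `χ(Γ)^*`: the regular points, i.e. the points with a neighbourhood on which
the dimension of the formal tangent space is constant. -/
def topStratum : Set (CharVar Γ) :=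
  {x | ∃ U ∈ 𝓝 x, ∃ d : ℕ, ∀ φ : RepSpace Γ, orbit φ ∈ U → Module.finrank ℝ (H1 φ) = d}

variable {Γ}

/-- A real function `f` on `χ(Γ)` is smooth on the open set `U` if its pullback to
`Hom(Γ, SU(2))` is, near every representation over `U`, the restriction of a smooth function
of the values (in the real vector space of quaternions) at finitely many group elements. -/
def SmoothFunOn (f : CharVar Γ → ℝ) (U : Set (CharVar Γ)) : Prop :=
  ∀ φ : RepSpace Γ, orbit φ ∈ U →
    ∃ (n : ℕ) (γ : Fin n → Γ) (F : (Fin n → ℍ[ℝ]) → ℝ),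
      (∃ W ∈ 𝓝 (fun i => (φ (γ i) : ℍ[ℝ])), ContDiffOn ℝ ∞ F W) ∧
      ∀ᶠ ψ in 𝓝 φ, f (orbit ψ) = F (fun i => (ψ (γ i) : ℍ[ℝ]))

/-- The curve `κ` in `χ(Γ)` lifts near time `0` to a smooth curve `σ` of representations with
`σ 0 = φ`, and the class of the cocycle `γ ↦ σ'(0)(γ) φ(γ)⁻¹` is `h`: that is, `h` is the
velocity of `κ` at time `0` under Weil's identification of tangent vectors with cohomology
classes. -/
def HasVelocity (κ : ℝ → CharVar Γ) (φ : RepSpace Γ) (h : H1 φ) : Prop :=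
  ∃ σ : ℝ → RepSpace Γ, σ 0 = φ ∧
    (∃ ε > 0, ∀ s ∈ Set.Ioo (-ε) ε, orbit (σ s) = κ s) ∧
    (∃ ε > 0, ∀ γ, ContDiffOn ℝ ∞ (fun s => (σ s γ : ℍ[ℝ])) (Set.Ioo (-ε) ε)) ∧
    ∃ z : Z1 φ, cls φ z = h ∧
      ∀ γ, HasDerivAt (fun s => (σ s γ : ℍ[ℝ])) ((z.1 γ : ℍ[ℝ]) * (φ γ : ℍ[ℝ])) 0

end CharacterVariety

/-! ### The torus, its fundamental group and the Dehn twists -/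

/-- The closed oriented surface `T` of genus one, `ℝ/ℤ × ℝ/ℤ`. -/
abbrev T : Type := UnitAddCircle × UnitAddCircle

/-- The base point. -/
def t₀ : T := (0, 0)

/-- The fundamental group of the torus. -/
abbrev π₁T : Type := FundamentalGroup T t₀

/-- The loop once around the circle `ℝ/ℤ`. -/
def circleLoop : Path (0 : UnitAddCircle) 0 where
  toFun s := ((s : ℝ) : UnitAddCircle)
  continuous_toFun := by
    exact (AddCircle.continuous_mk' (1 : ℝ)).comp continuous_subtype_val
  source' := by simp
  target' := by simp

/-- The class of the loop around the first circle factor. -/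
def mu : π₁T := FundamentalGroup.fromPath
  (Path.Homotopic.prod (Path.Homotopic.Quotient.mk circleLoop)
    (Path.Homotopic.Quotient.mk (Path.refl 0)))

/-- The class of the loop around the second circle factor. -/
def lam : π₁T := FundamentalGroup.fromPath
  (Path.Homotopic.prod (Path.Homotopic.Quotient.mk (Path.refl 0))
    (Path.Homotopic.Quotient.mk circleLoop))

theorem mu_mul_lam : mu * lam = lam * mu := by
  have h₁ : mu * lam = FundamentalGroup.fromPath
      (Path.Homotopic.prod (Path.Homotopic.Quotient.mk circleLoop)
        (Path.Homotopic.Quotient.mk circleLoop)) := by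
    refine (Path.Homotopic.comp_prod_eq_prod_comp _ _ _ _).trans ?_
    congr 1
    · exact Path.Homotopic.Quotient.refl_trans _
    · exact Path.Homotopic.Quotient.trans_refl _
  have h₂ : lam * mu = FundamentalGroup.fromPath
      (Path.Homotopic.prod (Path.Homotopic.Quotient.mk circleLoop)
        (Path.Homotopic.Quotient.mk circleLoop)) := by
    refine (Path.Homotopic.comp_prod_eq_prod_comp _ _ _ _).trans ?_
    congr 1
    · exact Path.Homotopic.Quotient.trans_refl _
    · exact Path.Homotopic.Quotient.refl_trans _
  rw [h₁, h₂]

/-- A map `ℝ/ℤ → ℝ/ℤ` of degree one which is constant equal to `0` outside `[1/4, 3/4]`. -/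
def twist : UnitAddCircle → UnitAddCircle :=
  AddCircle.liftIco (1 : ℝ) 0 (fun s => ((max 0 (min 1 (2 * s - 1 / 2)) : ℝ) : UnitAddCircle))

theorem continuous_twist : Continuous twist := by
  refine AddCircle.liftIco_continuous ?_ ?_
  · have h₀ : max 0 (min 1 (2 * (0 : ℝ) - 1 / 2)) = 0 := max_eq_left (by norm_num)
    have h₁ : max 0 (min 1 (2 * (0 + 1 : ℝ) - 1 / 2)) = 1 := by norm_num
    rw [h₀, h₁]
    exact (AddCircle.coe_period (1 : ℝ)).symm
  · refine Continuous.continuousOn ?_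
    exact (AddCircle.continuous_mk' (1 : ℝ)).comp (by fun_prop)

theorem twist_zero : twist 0 = 0 := by
  have h : twist ((0 : ℝ) : UnitAddCircle) =
      ((max 0 (min 1 (2 * 0 - 1 / 2)) : ℝ) : UnitAddCircle) :=
    AddCircle.liftIco_coe_apply (by norm_num)
  rw [max_eq_left (by norm_num)] at h
  simpa using h

/-- The Dehn twist about `μ`, supported in the annulus `ℝ/ℤ × [1/4, 3/4]`, whose core is
parallel to `μ`. -/
def dehnMu : T ≃ₜ T where
  toFun p := (p.1 + twist p.2, p.2)
  invFun p := (p.1 - twist p.2, p.2)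
  left_inv p := by simp
  right_inv p := by simp
  continuous_toFun := by
    have := continuous_twist
    fun_prop
  continuous_invFun := by
    have := continuous_twist
    fun_prop

/-- The Dehn twist (of the same handedness) about `λ`, supported in the annulus
`[1/4, 3/4] × ℝ/ℤ`, whose core is parallel to `λ`. -/
def dehnLam : T ≃ₜ T where
  toFun p := (p.1, p.2 - twist p.1)
  invFun p := (p.1, p.2 + twist p.1)
  left_inv p := by simp
  right_inv p := by simp
  continuous_toFun := by
    have := continuous_twist
    fun_prop
  continuous_invFun := by
    have := continuous_twist
    fun_prop

theorem dehnMu_t₀ : dehnMu t₀ = t₀ := by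
  change ((0 : UnitAddCircle) + twist 0, (0 : UnitAddCircle)) = (0, 0)
  rw [twist_zero, add_zero]

theorem dehnLam_t₀ : dehnLam t₀ = t₀ := by
  change ((0 : UnitAddCircle), (0 : UnitAddCircle) - twist 0) = (0, 0)
  rw [twist_zero, sub_zero]

/-- The endomorphism of `π₁(T, t₀)` induced by `D_μ`. -/
def dehnMuHom : π₁T →* π₁T := FundamentalGroup.mapOfEq (dehnMu : C(T, T)) dehnMu_t₀

/-- The endomorphism of `π₁(T, t₀)` induced by `D_λ`. -/
def dehnLamHom : π₁T →* π₁T := FundamentalGroup.mapOfEq (dehnLam : C(T, T)) dehnLam_t₀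

/-! ### The Atiyah-Bott-Goldman form of the torus -/

/-- The value at `(g, h)` of the cup product of two `1`-cochains, combined with the pairing
on the coefficients. -/
def cup (φ : RepSpace π₁T) (g h : π₁T) : Z1 φ →ₗ[ℝ] Z1 φ →ₗ[ℝ] ℝ :=
  LinearMap.mk₂ ℝ (fun z w => pairing (z.1 g) (Ad (φ g) (w.1 h)))
    (fun z z' w => by simp)
    (fun c z w => by simp)
    (fun z w w' => by simp)
    (fun c z w => by simp)

/-- The cup product of two cocycles evaluated on the fundamental class of `T`, represented by
the cycle `[μ|λ] - [λ|μ]` of the bar complex of `π₁(T)`. -/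
def omegaZ (φ : RepSpace π₁T) : Z1 φ →ₗ[ℝ] Z1 φ →ₗ[ℝ] ℝ := cup φ mu lam - cup φ lam mu

theorem omegaZ_apply (φ : RepSpace π₁T) (z w : Z1 φ) :
    omegaZ φ z w = pairing (z.1 mu) (Ad (φ mu) (w.1 lam))
      - pairing (z.1 lam) (Ad (φ lam) (w.1 mu)) := rfl

theorem omegaZ_left (φ : RepSpace π₁T) (z w : Z1 φ) (hz : cls φ z = 0) : omegaZ φ z w = 0 := by
  obtain ⟨a, ha⟩ := (cls_eq_zero_iff φ z).1 hz
  have hw := (groupCohomology.mem_cocycles₁_iff (A := adRep φ) w.1).1 w.2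
  have e₁ : w.1 (mu * lam) = Ad (φ mu) (w.1 lam) + w.1 mu := hw mu lam
  have e₂ : w.1 (lam * mu) = Ad (φ lam) (w.1 mu) + w.1 lam := hw lam mu
  rw [mu_mul_lam, e₂] at e₁
  have e₃ : pairing a (Ad (φ lam) (w.1 mu)) + pairing a (w.1 lam)
      = pairing a (Ad (φ mu) (w.1 lam)) + pairing a (w.1 mu) := by
    rw [← map_add, ← map_add, e₁]
  rw [omegaZ_apply, ha, ha, map_sub, map_sub, LinearMap.sub_apply, LinearMap.sub_apply,
    pairing_Ad, pairing_Ad]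
  linarith

theorem omegaZ_right (φ : RepSpace π₁T) (z w : Z1 φ) (hw : cls φ w = 0) : omegaZ φ z w = 0 := by
  obtain ⟨a, ha⟩ := (cls_eq_zero_iff φ w).1 hw
  have hz := (groupCohomology.mem_cocycles₁_iff (A := adRep φ) z.1).1 z.2
  have e₁ : z.1 (mu * lam) = Ad (φ mu) (z.1 lam) + z.1 mu := hz mu lam
  have e₂ : z.1 (lam * mu) = Ad (φ lam) (z.1 mu) + z.1 lam := hz lam mu
  rw [mu_mul_lam, e₂] at e₁
  have hc : Ad (φ lam) (Ad (φ mu) a) = Ad (φ mu) (Ad (φ lam) a) := by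
    rw [← Module.End.mul_apply, ← Module.End.mul_apply, ← map_mul, ← map_mul, ← map_mul,
      ← map_mul, mu_mul_lam]
  have e₃ : pairing (Ad (φ lam) (z.1 mu)) (Ad (φ lam) (Ad (φ mu) a))
        + pairing (z.1 lam) (Ad (φ lam) (Ad (φ mu) a))
      = pairing (Ad (φ mu) (z.1 lam)) (Ad (φ mu) (Ad (φ lam) a))
        + pairing (z.1 mu) (Ad (φ mu) (Ad (φ lam) a)) := by
    rw [hc, ← LinearMap.add_apply, ← LinearMap.add_apply, ← map_add, ← map_add, e₁]
  rw [pairing_Ad, pairing_Ad] at e₃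
  rw [omegaZ_apply, ha, ha, map_sub, map_sub, map_sub, map_sub]
  linarith

theorem omegaZ_congr (φ : RepSpace π₁T) {z z' w w' : Z1 φ} (hz : cls φ z = cls φ z')
    (hw : cls φ w = cls φ w') : omegaZ φ z w = omegaZ φ z' w' := by
  have h₁ := omegaZ_left φ (z - z') w ((LinearMap.map_sub (cls φ) z z').trans (sub_eq_zero.2 hz))
  have h₂ := omegaZ_right φ z' (w - w') ((LinearMap.map_sub (cls φ) w w').trans (sub_eq_zero.2 hw))
  have e₁ : omegaZ φ (z - z') w = omegaZ φ z w - omegaZ φ z' w :=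
    LinearMap.map_sub₂ (omegaZ φ) z z' w
  have e₂ : omegaZ φ z' (w - w') = omegaZ φ z' w - omegaZ φ z' w' :=
    LinearMap.map_sub (omegaZ φ z') w w'
  linarith

/-- The form `ω_T` on the formal tangent space `H¹(π₁(T); su(2)_{ad φ})`: the form on cocycles,
which depends only on cohomology classes. -/
def omega (φ : RepSpace π₁T) : H1 φ →ₗ[ℝ] H1 φ →ₗ[ℝ] ℝ :=
  LinearMap.mk₂ ℝ (fun h k => omegaZ φ (Function.surjInv (cls_surjective φ) h)
      (Function.surjInv (cls_surjective φ) k))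
    (fun h h' k => by
      rw [← LinearMap.add_apply, ← map_add]
      refine omegaZ_congr φ ?_ rfl
      simp only [map_add, Function.surjInv_eq])
    (fun c h k => by
      rw [← LinearMap.smul_apply, ← map_smul]
      refine omegaZ_congr φ ?_ rfl
      simp only [map_smul, Function.surjInv_eq])
    (fun h k k' => by
      rw [← map_add]
      refine omegaZ_congr φ rfl ?_
      simp only [map_add, Function.surjInv_eq])
    (fun c h k => by
      rw [← map_smul]
      refine omegaZ_congr φ rfl ?_
      simp only [map_smul, Function.surjInv_eq])

theorem omega_cls (φ : RepSpace π₁T) (z w : Z1 φ) :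
    omega φ (cls φ z) (cls φ w) = omegaZ φ z w :=
  omegaZ_congr φ (Function.surjInv_eq (cls_surjective φ) _)
    (Function.surjInv_eq (cls_surjective φ) _)

/-! ### The pillowcase -/

/-- The torus `𝕋 = U(1) × U(1)`. -/
abbrev UTorus : Type := Circle × Circle

/-- `SL(2, ℤ)`. -/
abbrev SL2Z : Type := Matrix.SpecialLinearGroup (Fin 2) ℤ

/-- `PSL(2, ℤ)`, the quotient of `SL(2, ℤ)` by its center `{1, -1}`. -/
abbrev PSL2Z : Type := Matrix.ProjectiveSpecialLinearGroup (Fin 2) ℤ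

/-- The action of `SL(2, ℤ)` on `𝕋`: the matrix with rows `(p, r)` and `(q, s)` sends
`(e^{ix}, e^{iy})` to `(e^{i(px+ry)}, e^{i(qx+sy)})`. -/
def slAct (A : SL2Z) (t : UTorus) : UTorus :=
  (t.1 ^ (A.1 0 0) * t.2 ^ (A.1 0 1), t.1 ^ (A.1 1 0) * t.2 ^ (A.1 1 1))

/-- The orbit relation of the elliptic involution `ι(z, w) = (z⁻¹, w⁻¹)`. -/
def ellipticSetoid : Setoid UTorus where
  r t t' := t' = t ∨ t' = t⁻¹
  iseqv :=
    { refl := fun t => Or.inl rfl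
      symm := by
        rintro t t' (h | h)
        · exact Or.inl h.symm
        · exact Or.inr (by rw [h, inv_inv])
      trans := by
        rintro t t' t'' (h | h) (h' | h')
        · exact Or.inl (by rw [h', h])
        · exact Or.inr (by rw [h', h])
        · exact Or.inr (by rw [h', h])
        · exact Or.inl (by rw [h', h, inv_inv]) }

/-- The pillowcase `ℙ = 𝕋 / ι`. -/
def Pillowcase : Type := Quotient ellipticSetoid

/-- The quotient topology. -/
instance : TopologicalSpace Pillowcase :=
  inferInstanceAs (TopologicalSpace (Quotient ellipticSetoid))

/-- The quotient map `𝕋 → ℙ`. -/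
def proj (t : UTorus) : Pillowcase := Quotient.mk ellipticSetoid t

/-- `ℙ^*`: the image of the set of points of `𝕋` that are not fixed by `ι`. -/
def pillowStar : Set Pillowcase := proj '' {t | t⁻¹ ≠ t}

theorem slAct_inv (A : SL2Z) (t : UTorus) : slAct A t⁻¹ = (slAct A t)⁻¹ := by
  ext1 <;> simp [slAct, mul_comm]

theorem slAct_one (t : UTorus) : slAct 1 t = t := by
  ext1 <;> simp [slAct]

theorem slAct_mul (A B : SL2Z) (t : UTorus) : slAct (A * B) t = slAct A (slAct B t) := by
  have h : ∀ (z w : Circle) (a b c d e f : ℤ),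
      z ^ (a * c + b * e) * w ^ (a * d + b * f) = (z ^ c * w ^ d) ^ a * (z ^ e * w ^ f) ^ b := by
    intro z w a b c d e f
    rw [mul_zpow, mul_zpow, ← zpow_mul, ← zpow_mul, ← zpow_mul, ← zpow_mul, zpow_add, zpow_add,
      mul_comm c a, mul_comm d a, mul_comm e b, mul_comm f b]
    exact mul_mul_mul_comm _ _ _ _
  have hAB : ∀ i j, (A * B).1 i j = A.1 i 0 * B.1 0 j + A.1 i 1 * B.1 1 j := by
    intro i j
    change (A.1 * B.1) i j = _
    rw [Matrix.mul_apply, Fin.sum_univ_two]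
  ext1
  · simp only [slAct, hAB]
    exact h _ _ _ _ _ _ _ _
  · simp only [slAct, hAB]
    exact h _ _ _ _ _ _ _ _

instance : MulAction SL2Z Pillowcase where
  smul A := Quotient.map (slAct A) (by
    rintro t t' (h | h)
    · exact Or.inl (by rw [h])
    · exact Or.inr (by rw [h, slAct_inv]))
  one_smul x := by
    induction x using Quotient.inductionOn with
    | h t => exact congrArg (Quotient.mk ellipticSetoid) (slAct_one t)
  mul_smul A B x := by
    induction x using Quotient.inductionOn with
    | h t => exact congrArg (Quotient.mk ellipticSetoid) (slAct_mul A B t)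

theorem smul_proj (A : SL2Z) (t : UTorus) : A • proj t = proj (slAct A t) := rfl

theorem center_smul (A : SL2Z) (hA : A ∈ Subgroup.center SL2Z) (x : Pillowcase) : A • x = x := by
  obtain ⟨r, hr, hA'⟩ := Matrix.SpecialLinearGroup.mem_center_iff.1 hA
  have h00 : A.1 0 0 = r := by
    rw [← congrFun (congrFun hA' 0) 0, Matrix.scalar_apply]
    simp
  have h01 : A.1 0 1 = 0 := by
    rw [← congrFun (congrFun hA' 0) 1, Matrix.scalar_apply]
    simp
  have h10 : A.1 1 0 = 0 := by
    rw [← congrFun (congrFun hA' 1) 0, Matrix.scalar_apply]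
    simp
  have h11 : A.1 1 1 = r := by
    rw [← congrFun (congrFun hA' 1) 1, Matrix.scalar_apply]
    simp
  have hr' : r = 1 ∨ r = -1 := by
    rw [Fintype.card_fin] at hr
    have h : (r - 1) * (r + 1) = 0 := by linear_combination hr
    rcases mul_eq_zero.1 h with h | h
    · exact Or.inl (by linarith)
    · exact Or.inr (by linarith)
  induction x using Quotient.inductionOn with
  | h t =>
    change proj (slAct A t) = proj t
    rcases hr' with h | h
    · congr 1
      ext1 <;> simp [slAct, h00, h01, h10, h11, h]
    · refine Quotient.sound (Or.inr ?_)
      ext1 <;> simp [slAct, h00, h01, h10, h11, h]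

/-- The induced action of `PSL(2, ℤ)` on `ℙ`. -/
instance : MulAction PSL2Z Pillowcase :=
  MulAction.compHom Pillowcase (QuotientGroup.lift (Subgroup.center SL2Z)
    (MulAction.toPermHom SL2Z Pillowcase)
    (fun A hA => Equiv.ext fun x => center_smul A hA x))

theorem mk_smul (A : SL2Z) (x : Pillowcase) : (QuotientGroup.mk A : PSL2Z) • x = A • x := rfl

/-- `(x, y) ↦ [e^{ix}, e^{iy}]`, which over `ℙ^*` is a local diffeomorphism and so gives the
local coordinates `x, y` on `ℙ^*`. -/
def coord (u : ℝ × ℝ) : Pillowcase := proj (Circle.exp u.1, Circle.exp u.2)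

/-- Smoothness of a real function on an open subset of `ℙ^*`. -/
def PSmoothFunOn (f : Pillowcase → ℝ) (U : Set Pillowcase) : Prop :=
  ContDiffOn ℝ ∞ (fun u => f (coord u)) (coord ⁻¹' U)

/-- Near time `0` the curve `κ` in `ℙ` is given in the coordinates `x, y` by a smooth curve that
is at `u` with velocity `v` at time `0`. -/
def PHasVelocity (κ : ℝ → Pillowcase) (u v : ℝ × ℝ) : Prop :=
  ∃ c : ℝ → ℝ × ℝ, c 0 = u ∧
    (∃ ε > 0, ∀ s ∈ Set.Ioo (-ε) ε, coord (c s) = κ s) ∧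
    (∃ ε > 0, ContDiffOn ℝ ∞ c (Set.Ioo (-ε) ε)) ∧ HasDerivAt c v 0

/-! ### Symplectomorphisms -/

/-- The homeomorphism `Φ` restricts to a symplectomorphism
`(ℙ^*, c dx ∧ dy) → (χ(T)^*, ω_T)`: it maps `ℙ^*` onto `χ(T)^*`, it and its inverse pull smooth
functions back to smooth functions, and its differential at every point of `ℙ^*` (the map `L` on
velocities of curves) is a linear isomorphism which pulls `ω_T` back to `c dx ∧ dy`. -/
structure IsSymplectoFromPillowcase (c : ℝ) (Φ : Pillowcase ≃ₜ CharVar π₁T) : Prop where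
  image_eq : Φ '' pillowStar = topStratum π₁T
  smooth_iff : ∀ V ⊆ topStratum π₁T, IsOpen V → ∀ f : CharVar π₁T → ℝ,
    SmoothFunOn f V ↔ PSmoothFunOn (fun x => f (Φ x)) (Φ ⁻¹' V)
  pullback_form : ∀ u : ℝ × ℝ, coord u ∈ pillowStar →
    ∀ φ : RepSpace π₁T, orbit φ = Φ (coord u) →
      ∃ L : (ℝ × ℝ) ≃ₗ[ℝ] H1 φ,
        (∀ κ v, PHasVelocity κ u v → ∀ h, HasVelocity (fun s => Φ (κ s)) φ h ↔ h = L v) ∧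
        ∀ v w, omega φ (L v) (L w) = c * (v.1 * w.2 - v.2 * w.1)

/-- The homeomorphism `Ψ` of `χ(T)` restricts to a symplectomorphism of `(χ(T)^*, ω_T)`. -/
structure IsSymplectoOfCharVar (Ψ : CharVar π₁T ≃ₜ CharVar π₁T) : Prop where
  image_eq : Ψ '' topStratum π₁T = topStratum π₁T
  smooth_iff : ∀ V ⊆ topStratum π₁T, IsOpen V → ∀ f : CharVar π₁T → ℝ,
    SmoothFunOn f V ↔ SmoothFunOn (fun x => f (Ψ x)) (Ψ ⁻¹' V)
  preserves_form : ∀ φ φ' : RepSpace π₁T, orbit φ ∈ topStratum π₁T → orbit φ' = Ψ (orbit φ) →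
    ∃ L : H1 φ ≃ₗ[ℝ] H1 φ',
      (∀ κ h, HasVelocity κ φ h → ∀ h', HasVelocity (fun s => Ψ (κ s)) φ' h' ↔ h' = L h) ∧
      ∀ h k, omega φ' (L h) (L k) = omega φ h k

/-- The maps `H¹(π₁(T); su(2)_{ad φ}) → H¹(π₁(T); su(2)_{ad (φ ∘ θ)})`, `[z] ↦ [z ∘ θ]`, between
formal tangent spaces preserve `ω_T`, at every representation `φ`. -/
def PreservesFormalForm (θ : π₁T →* π₁T) : Prop :=
  ∀ (φ : RepSpace π₁T) (z w : Z1 φ) (z' w' : Z1 (RepSpace.precomp θ φ)),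
    (∀ γ, z'.1 γ = z.1 (θ γ)) → (∀ γ, w'.1 γ = w.1 (θ γ)) →
      omega (RepSpace.precomp θ φ) (cls _ z') (cls _ w') = omega φ (cls φ z) (cls φ w)

/-- The embedding `e^{ix} ↦ e^{ix}` of `U(1)` in `SU(2)`. -/
def circleToSU2 (z : Circle) : SU2 :=
  ⟨((z : ℂ) : ℍ[ℝ]), by
    have h : (z : ℂ).re * (z : ℂ).re + (z : ℂ).im * (z : ℂ).im = 1 := by
      rw [← Complex.normSq_apply, Circle.normSq_coe]
    rw [Unitary.mem_iff]
    constructor <;> ext <;> simp <;> linarith⟩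

/-- The class in `PSL(2, ℤ)` of the matrix with rows `(1, 0)` and `(1, 1)`. -/
def matMu : PSL2Z := QuotientGroup.mk ⟨!![1, 0; 1, 1], by simp⟩

/-- The class in `PSL(2, ℤ)` of the matrix with rows `(1, -1)` and `(0, 1)`. -/
def matLam : PSL2Z := QuotientGroup.mk ⟨!![1, -1; 0, 1], by simp⟩

end Pillow

end

/-! Lifting loops through `ℝ → ℝ/ℤ` gives each loop in `T` two winding numbers. These determine its
class, so `π₁(T)` is free abelian on `mu` and `lam`, and a representation is a commuting pair of
unit quaternions. Such a pair lies in one circle `{a + b h}` with `h` a unit imaginary quaternion,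
and every such `h` is conjugate to `i`. Hence every class contains some `rho t`
(`exists_orbit_eq_rho`). The real parts at `mu`, `lam` and `mu * lam` determine `t` up to inversion
(`eq_or_inv_of_re`). So the induced map from the pillowcase is a continuous bijection, and its
target is Hausdorff because the characters separate points. Compactness makes it a homeomorphism,
`pillowHomeo`.

The action on `χ(T)` is the one on the pillowcase, transported. On pairs of values the Dehn twists
are `(A, B) ↦ (A, A B)` and `(A, B) ↦ (A B⁻¹, B)`, which are the two given unipotent matrices. These
generate `SL(2, ℤ)`, which gives uniqueness and the image. Faithfulness follows because `e^i` has
infinite order in the circle.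

At a noncentral representation, `su(2)` splits into the axis, fixed by the adjoint action, and an
orthogonal plane on which some group element rotates without fixed vectors. The plane contributes no
cohomology, since `π₁(T)` is abelian (`cls_eq_zero_of_axisComp`), and the axis contributes `Hom(ℤ²,
ℝ) = ℝ²`, the variations of the two angles. On these the form is `dx ∧ dy`, so `c = 1`. At central
representations a copy of `su(2)` embeds in `H¹`, so the dimension is not 2. As noncentral angles
are dense, the regular points are exactly the noncentral ones.

Smoothness rests on the explicit local angle functions `locCoord` of the values at `mu` and `lam`,
and velocities are read off by differentiating characters (`hasVelocity_iff`). In angle coordinates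
`SL(2, ℤ)` acts linearly with determinant one, so the action is symplectic. -/

noncomputable section

namespace Pillow

/-! ### The fundamental group of the torus -/

/-- The covering `ℝ → ℝ/ℤ`. -/
theorem isAddQuotientCoveringMap_circle : IsAddQuotientCoveringMap
    ((↑) : ℝ → UnitAddCircle) (AddSubgroup.zmultiples (1 : ℝ)) :=
  AddCircle.isAddQuotientCoveringMap_coe 1

/-- The lift `0 : ℝ` of the base point of `ℝ/ℤ`. -/
def zeroLift : ((↑) : ℝ → UnitAddCircle) ⁻¹' {0} := ⟨0, by simp⟩

/-- The end point of the lift to `ℝ` of a loop in `ℝ/ℤ`, as an element of the group of deck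
transformations. -/
def deck (p : Path.Homotopic.Quotient (0 : UnitAddCircle) 0) : AddSubgroup.zmultiples (1 : ℝ) :=
  (isAddQuotientCoveringMap_circle.fundamentalGroupToMulOpposite zeroLift
    (FundamentalGroup.fromPath p)).unop.toAdd

/-- Two reversals cancel: the product in the fundamental group is concatenation in the opposite
order, and the deck homomorphism takes values in the opposite group. -/
theorem deck_trans (p q : Path.Homotopic.Quotient (0 : UnitAddCircle) 0) :
    deck (p.trans q) = deck p + deck q := by
  have h : FundamentalGroup.fromPath (p.trans q)
      = FundamentalGroup.fromPath q * FundamentalGroup.fromPath p := rfl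
  simp only [deck, h, map_mul]
  rfl

theorem deck_injective : Function.Injective deck := fun _ _ h =>
  isAddQuotientCoveringMap_circle.fundamentalGroupToMulOpposite_injective zeroLift
    (MulOpposite.unop_injective h)

/-- By uniqueness of lifts, `f` is the lift of `p` starting at `0`, so its end point is the
monodromy. Winding numbers are thereby computed from any explicit real lift. -/
theorem deck_mk (p : Path (0 : UnitAddCircle) 0) (f : C(unitInterval, ℝ)) (h₀ : f 0 = 0)
    (h : ∀ s, p s = (f s : UnitAddCircle)) :
    (deck (Path.Homotopic.Quotient.mk p) : ℝ) = f 1 := by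
  have e := isAddQuotientCoveringMap_circle.unop_fundamentalGroupToMulOpposite_smul
    (e := zeroLift) (γ := FundamentalGroup.fromPath (Path.Homotopic.Quotient.mk p))
  have e₁ : (deck (Path.Homotopic.Quotient.mk p) : ℝ) + 0
      = isAddQuotientCoveringMap_circle.isCoveringMap.monodromy
          (Path.Homotopic.Quotient.mk p) zeroLift := e
  rw [add_zero] at e₁
  rw [e₁]
  have e₂ := (isAddQuotientCoveringMap_circle.isCoveringMap.eq_liftPath_iff' (γ := p) (e := 0)
    (by simp) (Γ := f)).2 ⟨funext fun s => (h s).symm, h₀⟩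
  rw [e₂]
  rfl

theorem exists_deck_eq (p : Path.Homotopic.Quotient (0 : UnitAddCircle) 0) :
    ∃ n : ℤ, (n : ℝ) = deck p := by
  obtain ⟨n, hn⟩ := AddSubgroup.mem_zmultiples_iff.1 (deck p).2
  exact ⟨n, by simpa using hn⟩

/-- The winding number of a loop in `ℝ/ℤ`. -/
def winding (p : Path.Homotopic.Quotient (0 : UnitAddCircle) 0) : ℤ :=
  (exists_deck_eq p).choose

theorem winding_cast (p : Path.Homotopic.Quotient (0 : UnitAddCircle) 0) :
    (winding p : ℝ) = deck p := (exists_deck_eq p).choose_spec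

theorem winding_trans (p q : Path.Homotopic.Quotient (0 : UnitAddCircle) 0) :
    winding (p.trans q) = winding p + winding q := by
  have h : (winding (p.trans q) : ℝ) = winding p + winding q := by
    rw [winding_cast, winding_cast, winding_cast, deck_trans]
    rfl
  exact_mod_cast h

theorem winding_injective : Function.Injective winding := fun p q h =>
  deck_injective (Subtype.ext (by rw [← winding_cast, ← winding_cast, h]))

theorem winding_mk (p : Path (0 : UnitAddCircle) 0) (f : C(unitInterval, ℝ)) (h₀ : f 0 = 0)
    (h : ∀ s, p s = (f s : UnitAddCircle)) (n : ℤ) (hn : f 1 = n) :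
    winding (Path.Homotopic.Quotient.mk p) = n := by
  have := deck_mk p f h₀ h
  rw [← winding_cast, hn] at this
  exact_mod_cast this

/-- The first component of a class of loops in the torus. -/
def fstLoop (γ : π₁T) : Path.Homotopic.Quotient (0 : UnitAddCircle) 0 :=
  Path.Homotopic.projLeft (γ : Path.Homotopic.Quotient t₀ t₀)

/-- The second component of a class of loops in the torus. -/
def sndLoop (γ : π₁T) : Path.Homotopic.Quotient (0 : UnitAddCircle) 0 :=
  Path.Homotopic.projRight (γ : Path.Homotopic.Quotient t₀ t₀)

theorem fstLoop_mul (γ δ : π₁T) : fstLoop (γ * δ) = (fstLoop δ).trans (fstLoop γ) := by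
  induction γ, δ using Path.Homotopic.Quotient.ind₂ with
  | mk p q => exact congrArg Path.Homotopic.Quotient.mk (Path.map_trans q p continuous_fst)

theorem sndLoop_mul (γ δ : π₁T) : sndLoop (γ * δ) = (sndLoop δ).trans (sndLoop γ) := by
  induction γ, δ using Path.Homotopic.Quotient.ind₂ with
  | mk p q => exact congrArg Path.Homotopic.Quotient.mk (Path.map_trans q p continuous_snd)

/-- The winding number of a loop in the torus around the first factor. -/
def windFst (γ : π₁T) : ℤ := winding (fstLoop γ)

/-- The winding number of a loop in the torus around the second factor. -/
def windSnd (γ : π₁T) : ℤ := winding (sndLoop γ)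

theorem windFst_mul (γ δ : π₁T) : windFst (γ * δ) = windFst γ + windFst δ := by
  rw [windFst, fstLoop_mul, winding_trans, add_comm]
  rfl

theorem windSnd_mul (γ δ : π₁T) : windSnd (γ * δ) = windSnd γ + windSnd δ := by
  rw [windSnd, sndLoop_mul, winding_trans, add_comm]
  rfl

/-- A loop class in a product is determined by its two projections, and winding numbers are
injective on each circle. Identities in `π₁T` thus reduce to integer identities. -/
theorem pi1_ext {γ δ : π₁T} (h₁ : windFst γ = windFst δ) (h₂ : windSnd γ = windSnd δ) :
    γ = δ := by
  have e (γ : π₁T) : Path.Homotopic.prod (fstLoop γ) (sndLoop γ) = γ :=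
    Path.Homotopic.prod_projLeft_projRight _
  rw [← e γ, ← e δ, winding_injective h₁, winding_injective h₂]

theorem wind_mk (p : Path t₀ t₀) (f g : C(unitInterval, ℝ)) (hf : f 0 = 0) (hg : g 0 = 0)
    (h : ∀ s, p s = ((f s : UnitAddCircle), (g s : UnitAddCircle))) (m n : ℤ) (hm : f 1 = m)
    (hn : g 1 = n) :
    windFst (FundamentalGroup.fromPath (Path.Homotopic.Quotient.mk p)) = m ∧
      windSnd (FundamentalGroup.fromPath (Path.Homotopic.Quotient.mk p)) = n :=
  ⟨winding_mk _ f hf (fun s => congrArg Prod.fst (h s)) m hm,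
    winding_mk _ g hg (fun s => congrArg Prod.snd (h s)) n hn⟩

/-- The path underlying `mu`. -/
def muPath : Path t₀ t₀ := circleLoop.prod (Path.refl 0)

/-- The path underlying `lam`. -/
def lamPath : Path t₀ t₀ := (Path.refl 0).prod circleLoop

theorem wind_mu : windFst mu = 1 ∧ windSnd mu = 0 :=
  wind_mk muPath ⟨fun s => (s : ℝ), by fun_prop⟩ (.const _ 0) rfl rfl (fun s => rfl) 1 0
    (by simp) (by simp)

theorem wind_lam : windFst lam = 0 ∧ windSnd lam = 1 :=
  wind_mk lamPath (.const _ 0) ⟨fun s => (s : ℝ), by fun_prop⟩ rfl rfl (fun s => rfl) 0 1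
    (by simp) (by simp)

/-- The winding number around the first factor, as a homomorphism. -/
def windFstHom : π₁T →* Multiplicative ℤ :=
  MonoidHom.mk' (fun γ => Multiplicative.ofAdd (windFst γ)) fun γ δ => by
    rw [windFst_mul, ofAdd_add]

/-- The winding number around the second factor, as a homomorphism. -/
def windSndHom : π₁T →* Multiplicative ℤ :=
  MonoidHom.mk' (fun γ => Multiplicative.ofAdd (windSnd γ)) fun γ δ => by
    rw [windSnd_mul, ofAdd_add]

theorem windFst_zpow (γ : π₁T) (n : ℤ) : windFst (γ ^ n) = n * windFst γ := by
  have h := congrArg Multiplicative.toAdd (map_zpow windFstHom γ n)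
  rw [toAdd_zpow, smul_eq_mul] at h
  exact h

theorem windSnd_zpow (γ : π₁T) (n : ℤ) : windSnd (γ ^ n) = n * windSnd γ := by
  have h := congrArg Multiplicative.toAdd (map_zpow windSndHom γ n)
  rw [toAdd_zpow, smul_eq_mul] at h
  exact h

theorem eq_mu_lam (γ : π₁T) : γ = mu ^ windFst γ * lam ^ windSnd γ := by
  apply pi1_ext
  · rw [windFst_mul, windFst_zpow, windFst_zpow, wind_mu.1, wind_lam.1]
    ring
  · rw [windSnd_mul, windSnd_zpow, windSnd_zpow, wind_mu.2, wind_lam.2]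
    ring

theorem commute_pi1 (γ δ : π₁T) : γ * δ = δ * γ :=
  pi1_ext (by rw [windFst_mul, windFst_mul, add_comm]) (by rw [windSnd_mul, windSnd_mul, add_comm])

/-! ### Effect of the Dehn twists on the fundamental group -/

theorem map_mk (F : C(T, T)) (hF : F t₀ = t₀) (p : Path t₀ t₀) :
    FundamentalGroup.mapOfEq F hF (FundamentalGroup.fromPath (Path.Homotopic.Quotient.mk p)) =
      FundamentalGroup.fromPath
        (Path.Homotopic.Quotient.mk ((p.map F.continuous).cast hF.symm hF.symm)) :=
  (FundamentalGroup.mapOfEq_apply F hF _).trans rfl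

/-- `liftIco` gives the formula only on `[0, 1)`. At `s = 1` both sides are `0` in `ℝ/ℤ`, so the
formula can be used along a whole loop. -/
theorem twist_coe {s : ℝ} (hs : s ∈ Set.Icc (0 : ℝ) 1) :
    twist s = ((max 0 (min 1 (2 * s - 1 / 2)) : ℝ) : UnitAddCircle) := by
  rcases eq_or_lt_of_le hs.2 with rfl | h
  · have e : ((1 : ℝ) : UnitAddCircle) = 0 := AddCircle.coe_period (1 : ℝ)
    have e' : max 0 (min 1 (2 * (1 : ℝ) - 1 / 2)) = 1 := by norm_num
    rw [e', e, twist_zero]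
  · exact AddCircle.liftIco_coe_apply ⟨hs.1, by linarith⟩

/-- The lift to `ℝ` of the map `twist`. -/
def twistLift : C(unitInterval, ℝ) :=
  ⟨fun s => max 0 (min 1 (2 * (s : ℝ) - 1 / 2)), by fun_prop⟩

theorem twistLift_zero : twistLift 0 = 0 := by simp [twistLift]

theorem twistLift_one : twistLift 1 = 1 := by
  change max 0 (min 1 (2 * (1 : ℝ) - 1 / 2)) = 1
  norm_num

theorem twist_unitInterval (s : unitInterval) : twist ((s : ℝ) : UnitAddCircle) = twistLift s :=
  twist_coe s.2

theorem dehnMuHom_mu : dehnMuHom mu = mu := by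
  have h := wind_mk ((muPath.map (dehnMu : C(T, T)).continuous).cast dehnMu_t₀.symm dehnMu_t₀.symm)
    ⟨fun s => (s : ℝ), by fun_prop⟩ (.const _ 0) rfl rfl (fun s => by
      change (((s : ℝ) : UnitAddCircle) + twist 0, (0 : UnitAddCircle)) = _
      rw [twist_zero, add_zero]
      rfl) 1 0 (by simp) (by simp)
  rw [← map_mk _ dehnMu_t₀] at h
  exact pi1_ext (h.1.trans wind_mu.1.symm) (h.2.trans wind_mu.2.symm)

/-- The image of the loop `lam` lifts to the plane as `s ↦ (twistLift s, s)`, which ends at `(1,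
1)`. -/
theorem dehnMuHom_lam : dehnMuHom lam = mu * lam := by
  have h := wind_mk
    ((lamPath.map (dehnMu : C(T, T)).continuous).cast dehnMu_t₀.symm dehnMu_t₀.symm)
    twistLift ⟨fun s => (s : ℝ), by fun_prop⟩ twistLift_zero rfl (fun s => by
      change ((0 : UnitAddCircle) + twist ((s : ℝ) : UnitAddCircle), ((s : ℝ) : UnitAddCircle)) = _
      rw [twist_unitInterval, zero_add]
      rfl) 1 1 (by simp [twistLift_one]) (by simp)
  rw [← map_mk _ dehnMu_t₀] at h
  refine pi1_ext (h.1.trans ?_) (h.2.trans ?_)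
  · rw [windFst_mul, wind_mu.1, wind_lam.1]
    rfl
  · rw [windSnd_mul, wind_mu.2, wind_lam.2]
    rfl

theorem dehnLamHom_lam : dehnLamHom lam = lam := by
  have h := wind_mk
    ((lamPath.map (dehnLam : C(T, T)).continuous).cast dehnLam_t₀.symm dehnLam_t₀.symm)
    (.const _ 0) ⟨fun s => (s : ℝ), by fun_prop⟩ rfl rfl (fun s => by
      change ((0 : UnitAddCircle), ((s : ℝ) : UnitAddCircle) - twist 0) = _
      rw [twist_zero, sub_zero]
      rfl) 0 1 (by simp) (by simp)
  rw [← map_mk _ dehnLam_t₀] at h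
  exact pi1_ext (h.1.trans wind_lam.1.symm) (h.2.trans wind_lam.2.symm)

/-- The image of the loop `mu` lifts to `s ↦ (s, -twistLift s)`, which ends at `(1, -1)`. -/
theorem dehnLamHom_mu : dehnLamHom mu = mu * lam⁻¹ := by
  have h := wind_mk
    ((muPath.map (dehnLam : C(T, T)).continuous).cast dehnLam_t₀.symm dehnLam_t₀.symm)
    ⟨fun s => (s : ℝ), by fun_prop⟩ (-twistLift) rfl (by simp [twistLift_zero]) (fun s => by
      change (((s : ℝ) : UnitAddCircle), (0 : UnitAddCircle) - twist ((s : ℝ) : UnitAddCircle)) = _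
      rw [twist_unitInterval, zero_sub]
      rfl) 1 (-1) (by simp) (by simp [twistLift_one])
  rw [← map_mk _ dehnLam_t₀] at h
  refine pi1_ext (h.1.trans ?_) (h.2.trans ?_)
  · rw [← zpow_neg_one]
    rw [windFst_mul, windFst_zpow, wind_mu.1, wind_lam.1]
    rfl
  · rw [← zpow_neg_one]
    rw [windSnd_mul, windSnd_zpow, wind_mu.2, wind_lam.2]
    rfl

/-! ### Representations of the fundamental group of the torus -/

theorem rep_apply (φ : RepSpace π₁T) (γ : π₁T) :
    φ γ = φ mu ^ windFst γ * φ lam ^ windSnd γ := by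
  conv_lhs => rw [eq_mu_lam γ]
  rw [map_mul, map_zpow, map_zpow]

theorem rep_ext {φ ψ : RepSpace π₁T} (h₁ : φ mu = ψ mu) (h₂ : φ lam = ψ lam) : φ = ψ :=
  DFunLike.ext _ _ fun γ => by rw [rep_apply φ, rep_apply ψ, h₁, h₂]

/-- The representation with prescribed commuting values on `mu` and `lam`. -/
def repMk (A B : SU2) (h : Commute A B) : RepSpace π₁T :=
  MonoidHom.mk' (fun γ => A ^ windFst γ * B ^ windSnd γ) fun γ δ => by
    rw [windFst_mul, windSnd_mul, zpow_add, zpow_add]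
    have := (h.zpow_zpow (windFst δ) (windSnd γ)).eq
    simp only [mul_assoc]
    rw [← mul_assoc (A ^ windFst δ), this, mul_assoc]

theorem repMk_apply (A B : SU2) (h : Commute A B) (γ : π₁T) :
    repMk A B h γ = A ^ windFst γ * B ^ windSnd γ := rfl

theorem repMk_mu (A B : SU2) (h : Commute A B) : repMk A B h mu = A := by
  simp [repMk_apply, wind_mu]

theorem repMk_lam (A B : SU2) (h : Commute A B) : repMk A B h lam = B := by
  simp [repMk_apply, wind_lam]

/-! ### Commuting pairs of unit quaternions -/

/-- The unit imaginary quaternions. -/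
def IsAxis (h : ℍ[ℝ]) : Prop := h.re = 0 ∧ h.imI ^ 2 + h.imJ ^ 2 + h.imK ^ 2 = 1

/-- The point `Re z + (Im z) h` of the copy of `ℂ` spanned by `1` and `h`. -/
def axisPt (h : ℍ[ℝ]) (z : ℂ) : ℍ[ℝ] := (z.re : ℍ[ℝ]) + z.im • h

/-- The orthogonal projection to the span of `1` and `h`, read as a complex number. -/
def axisProj (h A : ℍ[ℝ]) : ℂ := ⟨A.re, A.imI * h.imI + A.imJ * h.imJ + A.imK * h.imK⟩

/-- The quaternion `i`. -/
def qi : ℍ[ℝ] := ⟨0, 1, 0, 0⟩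

@[simp] theorem qi_re : qi.re = 0 := rfl

@[simp] theorem qi_imI : qi.imI = 1 := rfl

@[simp] theorem qi_imJ : qi.imJ = 0 := rfl

@[simp] theorem qi_imK : qi.imK = 0 := rfl

/-- The quaternion `j`. -/
def qj : ℍ[ℝ] := ⟨0, 0, 1, 0⟩

theorem qj_mul_qi : qj * qi = -qi * qj := by
  ext <;> simp [show qj.re = 0 from rfl, show qj.imI = 0 from rfl, show qj.imJ = 1 from rfl,
    show qj.imK = 0 from rfl]

theorem isAxis_qi : IsAxis qi := by simp [IsAxis]

theorem SU2_normSq (g : SU2) : (g : ℍ[ℝ]).re ^ 2 + (g : ℍ[ℝ]).imI ^ 2 + (g : ℍ[ℝ]).imJ ^ 2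
    + (g : ℍ[ℝ]).imK ^ 2 = 1 := by
  have h := congrArg (fun x : ℍ[ℝ] => x.re) g.2.1
  simp only [Quaternion.re_mul, Quaternion.re_star, Quaternion.imI_star, Quaternion.imJ_star,
    Quaternion.imK_star, Quaternion.re_one] at h
  linarith

theorem mem_SU2 {q : ℍ[ℝ]} (h : q.re ^ 2 + q.imI ^ 2 + q.imJ ^ 2 + q.imK ^ 2 = 1) :
    q ∈ unitary ℍ[ℝ] := by
  rw [Unitary.mem_iff]
  constructor <;> ext <;> simp <;> linarith

theorem coe_conj (g A : SU2) : ((g * A * g⁻¹ : SU2) : ℍ[ℝ]) = g * A * star (g : ℍ[ℝ]) := rfl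

theorem exists_normalize {q : ℍ[ℝ]} (h : q ≠ 0) :
    ∃ g : SU2, ∃ c : ℝ, 0 < c ∧ q = c • (g : ℍ[ℝ]) := by
  have hq : ‖q‖ ≠ 0 := norm_ne_zero_iff.2 h
  have h₂ : ‖q‖ * ‖q‖ = q.re ^ 2 + q.imI ^ 2 + q.imJ ^ 2 + q.imK ^ 2 := by
    rw [← Quaternion.normSq_eq_norm_mul_self, Quaternion.normSq_def']
  refine ⟨⟨‖q‖⁻¹ • q, mem_SU2 ?_⟩, ‖q‖, norm_pos_iff.2 h, ?_⟩
  · simp only [Quaternion.re_smul, Quaternion.imI_smul, Quaternion.imJ_smul, Quaternion.imK_smul,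
      smul_eq_mul]
    field_simp
    linarith
  · rw [smul_smul, mul_inv_cancel₀ hq, one_smul]

/-- Every unit imaginary quaternion is conjugate to `i`. -/
theorem exists_conj_qi {h : ℍ[ℝ]} (hh : IsAxis h) :
    ∃ g : SU2, (g : ℍ[ℝ]) * qi * star (g : ℍ[ℝ]) = h := by
  obtain ⟨h₀, h₁⟩ := hh
  -- Since `h² = i² = -1`, the sum `h + i` satisfies `(h + i) i = h (h + i)`. It vanishes only for
  -- `h = -i`, where `j` intertwines instead.
  obtain ⟨q, hq, e⟩ : ∃ q : ℍ[ℝ], q ≠ 0 ∧ q * qi = h * q := by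
    by_cases hi : h + qi = 0
    · refine ⟨qj, fun e => one_ne_zero (congrArg (fun x : ℍ[ℝ] => x.imJ) e), ?_⟩
      rw [eq_neg_of_add_eq_zero_left hi, qj_mul_qi]
    · refine ⟨h + qi, hi, ?_⟩
      ext <;> simp [h₀] <;> linarith
  obtain ⟨g, c, hc, rfl⟩ := exists_normalize hq
  refine ⟨g, ?_⟩
  have e' : (g : ℍ[ℝ]) * qi = h * g := by
    rw [smul_mul_assoc, mul_smul_comm] at e
    exact smul_right_injective _ hc.ne' e
  rw [e', mul_assoc, g.2.2, mul_one]

theorem axisPt_conj (g : SU2) (z : ℂ) :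
    axisPt ((g : ℍ[ℝ]) * qi * star (g : ℍ[ℝ])) z
      = (g : ℍ[ℝ]) * axisPt qi z * star (g : ℍ[ℝ]) := by
  have h : (g : ℍ[ℝ]) * star (g : ℍ[ℝ]) = 1 := g.2.2
  rw [axisPt, axisPt, mul_add, add_mul, ← Quaternion.coe_commutes, mul_assoc (z.re : ℍ[ℝ]), h,
    mul_one, mul_smul_comm, smul_mul_assoc]

theorem coe_circleToSU2 (z : Circle) : (circleToSU2 z : ℍ[ℝ]) = axisPt qi z := by
  change ((z : ℂ) : ℍ[ℝ]) = _
  ext <;> simp [axisPt]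

/-- Commuting with `h` makes the cross product of `h` with the imaginary part of `A` vanish, so that
part is a multiple of the unit vector `h` and projection loses nothing. -/
theorem axisPt_axisProj {h A : ℍ[ℝ]} (hh : IsAxis h) (hA : Commute A h) :
    axisPt h (axisProj h A) = A := by
  obtain ⟨h₀, h₁⟩ := hh
  have e := hA.eq
  have eI := congrArg (fun x : ℍ[ℝ] => x.imI) e
  have eJ := congrArg (fun x : ℍ[ℝ] => x.imJ) e
  have eK := congrArg (fun x : ℍ[ℝ] => x.imK) e
  simp [h₀] at eI eJ eK
  ext
  · simp [axisPt, axisProj, h₀]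
  · simp [axisPt, axisProj]
    linear_combination A.imI * h₁ - h.imJ * eK / 2 + h.imK * eJ / 2
  · simp [axisPt, axisProj]
    linear_combination A.imJ * h₁ - h.imK * eI / 2 + h.imI * eK / 2
  · simp [axisPt, axisProj]
    linear_combination A.imK * h₁ - h.imI * eJ / 2 + h.imJ * eI / 2

theorem axisProj_axisPt {h : ℍ[ℝ]} (hh : IsAxis h) (z : ℂ) : axisProj h (axisPt h z) = z := by
  obtain ⟨h₀, h₁⟩ := hh
  apply Complex.ext
  · simp [axisPt, axisProj, h₀]
  · simp [axisPt, axisProj]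
    linear_combination z.im * h₁

theorem axisPt_sq {h : ℍ[ℝ]} (hh : IsAxis h) (z : ℂ) :
    (axisPt h z).re ^ 2 + (axisPt h z).imI ^ 2 + (axisPt h z).imJ ^ 2 + (axisPt h z).imK ^ 2
      = Complex.normSq z := by
  obtain ⟨h₀, h₁⟩ := hh
  simp [axisPt, h₀, Complex.normSq_apply]
  linear_combination z.im ^ 2 * h₁

theorem exists_circle_axis {h : ℍ[ℝ]} (hh : IsAxis h) (A : SU2) (hA : Commute (A : ℍ[ℝ]) h) :
    ∃ z : Circle, (z : ℂ) = axisProj h A ∧ (A : ℍ[ℝ]) = axisPt h z := by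
  have e := axisPt_axisProj hh hA
  refine ⟨⟨axisProj h A, mem_sphere_zero_iff_norm.2 ?_⟩, rfl, e.symm⟩
  have h₁ := axisPt_sq hh (axisProj h A)
  rw [e, SU2_normSq, Complex.normSq_eq_norm_sq] at h₁
  nlinarith [norm_nonneg (axisProj h A)]

/-! ### The map `ρ` -/

/-- The embedding of `U(1)` in `SU(2)`, as a homomorphism. -/
def circleHom : Circle →* SU2 := MonoidHom.mk' circleToSU2 fun z w => by
  apply Subtype.ext
  change ((z * w : Circle) : ℂ) = ((z : ℂ) : ℍ[ℝ]) * ((w : ℂ) : ℍ[ℝ])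
  rw [Circle.coe_mul]
  ext <;> simp

theorem circleHom_apply (z : Circle) : circleHom z = circleToSU2 z := rfl

/-- The representation sending `μ` and `λ` to the given elements of `U(1)`. -/
def rho (t : UTorus) : RepSpace π₁T :=
  repMk (circleToSU2 t.1) (circleToSU2 t.2) (by
    rw [← circleHom_apply, ← circleHom_apply, commute_iff_eq, ← map_mul, ← map_mul, mul_comm])

theorem rho_apply (t : UTorus) (γ : π₁T) :
    rho t γ = circleToSU2 (t.1 ^ windFst γ * t.2 ^ windSnd γ) := by
  rw [rho, repMk_apply, ← circleHom_apply, ← circleHom_apply, ← circleHom_apply, map_mul,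
    map_zpow, map_zpow]

theorem eq_rho_iff (t : UTorus) (φ : RepSpace π₁T) :
    φ = rho t ↔ φ mu = circleToSU2 t.1 ∧ φ lam = circleToSU2 t.2 := by
  constructor
  · rintro rfl
    exact ⟨repMk_mu _ _ _, repMk_lam _ _ _⟩
  · rintro ⟨h₁, h₂⟩
    exact rep_ext (h₁.trans (repMk_mu _ _ _).symm) (h₂.trans (repMk_lam _ _ _).symm)

theorem orbit_eq_iff (φ ψ : RepSpace π₁T) :
    orbit φ = orbit ψ ↔ ∃ g : SU2, ∀ γ, ψ γ = g * φ γ * g⁻¹ :=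
  Quotient.eq (r := conjSetoid π₁T)

theorem orbit_eq_of_gens {φ ψ : RepSpace π₁T} (g : SU2) (h₁ : ψ mu = g * φ mu * g⁻¹)
    (h₂ : ψ lam = g * φ lam * g⁻¹) : orbit φ = orbit ψ := by
  rw [orbit_eq_iff]
  refine ⟨g, fun γ => ?_⟩
  rw [rep_apply ψ, rep_apply φ, h₁, h₂, conj_zpow, conj_zpow]
  group

theorem orbit_eq_rho_of_axis {φ : RepSpace π₁T} {h : ℍ[ℝ]} (hh : IsAxis h) {z w : Circle}
    (h₁ : (φ mu : ℍ[ℝ]) = axisPt h z) (h₂ : (φ lam : ℍ[ℝ]) = axisPt h w) :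
    orbit φ = orbit (rho (z, w)) := by
  obtain ⟨g, rfl⟩ := exists_conj_qi hh
  obtain ⟨e₁, e₂⟩ := (eq_rho_iff (z, w) _).1 rfl
  refine (orbit_eq_of_gens g ?_ ?_).symm
  · apply Subtype.ext
    rw [h₁, axisPt_conj, coe_conj, e₁, coe_circleToSU2]
  · apply Subtype.ext
    rw [h₂, axisPt_conj, coe_conj, e₂, coe_circleToSU2]

/-- The same representation is read along the axis `-i`, where all angles change sign. As `-i` is
conjugate to `i`, this gives the elliptic involution. -/
theorem orbit_rho_inv (t : UTorus) : orbit (rho t⁻¹) = orbit (rho t) := by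
  have h : IsAxis (-qi) := by simp [IsAxis]
  obtain ⟨e₁, e₂⟩ := (eq_rho_iff t _).1 rfl
  have e (z : Circle) : axisPt qi z = axisPt (-qi) (z⁻¹ : Circle) := by
    simp [axisPt]
  refine (orbit_eq_rho_of_axis h (z := t.1⁻¹) (w := t.2⁻¹) ?_ ?_).symm
  · rw [e₁, coe_circleToSU2, e]
  · rw [e₂, coe_circleToSU2, e]

theorem commute_values (φ : RepSpace π₁T) (γ δ : π₁T) :
    Commute (φ γ : ℍ[ℝ]) (φ δ : ℍ[ℝ]) := by
  have h : φ γ * φ δ = φ δ * φ γ := by rw [← map_mul, ← map_mul, commute_pi1]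
  exact congrArg Subtype.val h

theorem commute_im {a b : ℍ[ℝ]} (h : Commute a b) : Commute a b.im := by
  have e : b.im = b - (b.re : ℍ[ℝ]) := by
    rw [eq_sub_iff_add_eq, add_comm]
    exact Quaternion.re_add_im b
  rw [e]
  exact h.sub_right (Quaternion.coe_commutes b.re a).symm

theorem isAxis_normalize {N : ℍ[ℝ]} (hN : N ≠ 0) (h₀ : N.re = 0) : IsAxis (‖N‖⁻¹ • N) := by
  have hq : ‖N‖ ≠ 0 := norm_ne_zero_iff.2 hN
  have h₂ : ‖N‖ * ‖N‖ = N.re ^ 2 + N.imI ^ 2 + N.imJ ^ 2 + N.imK ^ 2 := by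
    rw [← Quaternion.normSq_eq_norm_mul_self, Quaternion.normSq_def']
  refine ⟨by simp [h₀], ?_⟩
  simp only [Quaternion.imI_smul, Quaternion.imJ_smul, Quaternion.imK_smul, smul_eq_mul]
  field_simp
  rw [h₀] at h₂
  linarith

/-- If a generator has a non-real value, the normalized imaginary part of that value is an axis: the
image is abelian, so everything commutes with it. If both values are real, any axis serves. -/
theorem exists_axis (φ : RepSpace π₁T) :
    ∃ h, IsAxis h ∧ Commute (φ mu : ℍ[ℝ]) h ∧ Commute (φ lam : ℍ[ℝ]) h := by
  have key : ∀ δ, (φ δ : ℍ[ℝ]).im ≠ 0 →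
      ∃ h, IsAxis h ∧ Commute (φ mu : ℍ[ℝ]) h ∧ Commute (φ lam : ℍ[ℝ]) h := fun δ hδ =>
    ⟨_, isAxis_normalize hδ (Quaternion.re_im _),
      (commute_im (commute_values φ mu δ)).smul_right _,
      (commute_im (commute_values φ lam δ)).smul_right _⟩
  by_cases h₁ : (φ mu : ℍ[ℝ]).im = 0
  · by_cases h₂ : (φ lam : ℍ[ℝ]).im = 0
    · refine ⟨qi, isAxis_qi, ?_, ?_⟩
      · rw [← Quaternion.re_add_im (φ mu : ℍ[ℝ]), h₁, add_zero]
        exact Quaternion.coe_commutes _ _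
      · rw [← Quaternion.re_add_im (φ lam : ℍ[ℝ]), h₂, add_zero]
        exact Quaternion.coe_commutes _ _
    · exact key lam h₂
  · exact key mu h₁

theorem exists_orbit_eq_rho (φ : RepSpace π₁T) : ∃ t, orbit φ = orbit (rho t) := by
  obtain ⟨h, hh, h₁, h₂⟩ := exists_axis φ
  obtain ⟨z, -, hz⟩ := exists_circle_axis hh _ h₁
  obtain ⟨w, -, hw⟩ := exists_circle_axis hh _ h₂
  exact ⟨(z, w), orbit_eq_rho_of_axis hh hz hw⟩

/-! ### The homeomorphism from the pillowcase -/

theorem re_conj (g A : SU2) : ((g * A * g⁻¹ : SU2) : ℍ[ℝ]).re = (A : ℍ[ℝ]).re := by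
  have hc : ∀ a b : ℍ[ℝ], (a * b).re = (b * a).re := by
    intro a b
    simp
    ring
  have hg : star (g : ℍ[ℝ]) * (g : ℍ[ℝ]) = 1 := g.2.1
  rw [coe_conj, hc, ← mul_assoc, hg, one_mul]

/-- The character at `γ`, as a function on the character variety. -/
def character (γ : π₁T) : CharVar π₁T → ℝ :=
  Quotient.lift (fun φ : RepSpace π₁T => (φ γ : ℍ[ℝ]).re) (by
    rintro φ ψ ⟨g, h⟩
    rw [h, re_conj])

theorem character_orbit (γ : π₁T) (φ : RepSpace π₁T) :
    character γ (orbit φ) = (φ γ : ℍ[ℝ]).re := rfl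

theorem continuous_eval (γ : π₁T) : Continuous fun φ : RepSpace π₁T => φ γ :=
  (continuous_apply γ).comp continuous_induced_dom

theorem continuous_orbit : Continuous (orbit : RepSpace π₁T → CharVar π₁T) :=
  continuous_quotient_mk'

theorem continuous_character (γ : π₁T) : Continuous (character γ) :=
  Continuous.quotient_lift
    (Quaternion.continuous_re.comp (continuous_subtype_val.comp (continuous_eval γ))) _

theorem character_rho (γ : π₁T) (t : UTorus) :
    character γ (orbit (rho t)) = ((t.1 ^ windFst γ * t.2 ^ windSnd γ : Circle) : ℂ).re := by
  rw [character_orbit, rho_apply, coe_circleToSU2]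
  simp [axisPt]

theorem circle_sq (z : Circle) : (z : ℂ).re ^ 2 + (z : ℂ).im ^ 2 = 1 := by
  have h := Circle.normSq_coe z
  rw [Complex.normSq_apply] at h
  linarith

theorem circle_ext {z w : Circle} (h₁ : (z : ℂ).re = (w : ℂ).re) (h₂ : (z : ℂ).im = (w : ℂ).im) :
    z = w := Circle.ext (Complex.ext h₁ h₂)

theorem circle_inv_ext {z w : Circle} (h₁ : (z : ℂ).re = (w : ℂ).re)
    (h₂ : (z : ℂ).im = -(w : ℂ).im) : z = w⁻¹ :=
  circle_ext (by simpa [Circle.coe_inv_eq_conj] using h₁)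
    (by simpa [Circle.coe_inv_eq_conj] using h₂)

/-- Equal cosines determine each sine up to sign. The real part of the product fixes the product of
the sines, so the two signs are chosen together. -/
theorem eq_or_inv_of_re {z w z' w' : Circle} (h₁ : (z : ℂ).re = (z' : ℂ).re)
    (h₂ : (w : ℂ).re = (w' : ℂ).re) (h₃ : ((z * w : Circle) : ℂ).re = ((z' * w' : Circle) : ℂ).re) :
    (z = z' ∧ w = w') ∨ (z = z'⁻¹ ∧ w = w'⁻¹) := by
  have e₁ := circle_sq z
  have e₁' := circle_sq z'
  have e₂ := circle_sq w
  have e₂' := circle_sq w'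
  simp only [Circle.coe_mul, Complex.mul_re] at h₃
  rw [h₁, h₂] at h₃
  rw [h₁] at e₁
  rw [h₂] at e₂
  have e₃ : (z : ℂ).im * (w : ℂ).im = (z' : ℂ).im * (w' : ℂ).im := by linarith
  have f₁ : (z : ℂ).im ^ 2 = (z' : ℂ).im ^ 2 := by linarith
  have f₂ : (w : ℂ).im ^ 2 = (w' : ℂ).im ^ 2 := by linarith
  by_cases hz : (z' : ℂ).im = 0
  · have hz' : (z : ℂ).im = 0 := by
      rw [hz] at f₁
      simpa using f₁
    rcases sq_eq_sq_iff_eq_or_eq_neg.1 f₂ with h | h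
    · exact Or.inl ⟨circle_ext h₁ (by rw [hz, hz']), circle_ext h₂ h⟩
    · exact Or.inr ⟨circle_inv_ext h₁ (by rw [hz, hz', neg_zero]), circle_inv_ext h₂ h⟩
  · rcases sq_eq_sq_iff_eq_or_eq_neg.1 f₁ with h | h
    · rw [h] at e₃
      exact Or.inl ⟨circle_ext h₁ h, circle_ext h₂ (mul_left_cancel₀ hz e₃)⟩
    · rw [h] at e₃
      refine Or.inr ⟨circle_inv_ext h₁ h, circle_inv_ext h₂ (mul_left_cancel₀ hz ?_)⟩
      linarith

theorem eq_or_inv_of_character {t t' : UTorus}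
    (h : ∀ γ, character γ (orbit (rho t)) = character γ (orbit (rho t'))) :
    t' = t ∨ t' = t⁻¹ := by
  have h₁ := h mu
  have h₂ := h lam
  have h₃ := h (mu * lam)
  simp only [character_rho, windFst_mul, windSnd_mul, wind_mu, wind_lam, add_zero, zero_add,
    zpow_one, zpow_zero, mul_one, one_mul] at h₁ h₂ h₃
  rcases eq_or_inv_of_re h₁.symm h₂.symm h₃.symm with ⟨e₁, e₂⟩ | ⟨e₁, e₂⟩
  · exact Or.inl (Prod.ext e₁ e₂)
  · exact Or.inr (Prod.ext e₁ e₂)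

/-- This makes `CharVar π₁T` Hausdorff, as the characters are continuous, and so lets compactness
turn the bijection `pillowMap` into a homeomorphism. -/
theorem character_injective :
    Function.Injective fun (x : CharVar π₁T) (γ : π₁T) => character γ x := by
  intro x y h
  induction x using Quotient.inductionOn with
  | h φ =>
    induction y using Quotient.inductionOn with
    | h ψ =>
      change orbit φ = orbit ψ
      change (fun γ => character γ (orbit φ)) = fun γ => character γ (orbit ψ) at h
      obtain ⟨t, ht⟩ := exists_orbit_eq_rho φ
      obtain ⟨t', ht'⟩ := exists_orbit_eq_rho ψ
      rw [ht, ht'] at h ⊢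
      rcases eq_or_inv_of_character (congrFun h) with rfl | rfl
      · rfl
      · exact (orbit_rho_inv _).symm

instance : T2Space (CharVar π₁T) :=
  T2Space.of_injective_continuous character_injective
    (continuous_pi fun γ => continuous_character γ)

theorem continuous_circleToSU2 : Continuous circleToSU2 := by
  refine Topology.IsInducing.subtypeVal.continuous_iff.2 ?_
  change Continuous fun z => (circleToSU2 z : ℍ[ℝ])
  simp only [coe_circleToSU2, axisPt]
  exact (Quaternion.continuous_coe.comp (Complex.continuous_re.comp continuous_subtype_val)).add
    ((Complex.continuous_im.comp continuous_subtype_val).smul continuous_const)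

theorem continuous_rho : Continuous rho := by
  refine continuous_induced_rng.2 (continuous_pi fun γ => ?_)
  change Continuous fun t : UTorus => rho t γ
  simp only [rho_apply]
  exact continuous_circleToSU2.comp (by fun_prop)

instance : CompactSpace Pillowcase := inferInstanceAs (CompactSpace (Quotient ellipticSetoid))

/-- The map `ℙ → χ(T)` induced by `rho`. -/
def pillowMap : Pillowcase → CharVar π₁T :=
  Quotient.lift (fun t => orbit (rho t)) (by
    rintro t t' (rfl | rfl)
    · rfl
    · exact (orbit_rho_inv t).symm)

theorem pillowMap_bijective : Function.Bijective pillowMap := by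
  constructor
  · intro x y h
    induction x using Quotient.inductionOn with
    | h t =>
      induction y using Quotient.inductionOn with
      | h t' =>
        change orbit (rho t) = orbit (rho t') at h
        exact Quotient.sound (eq_or_inv_of_character fun γ => by rw [h])
  · intro y
    induction y using Quotient.inductionOn with
    | h φ =>
      obtain ⟨t, ht⟩ := exists_orbit_eq_rho φ
      exact ⟨proj t, ht.symm⟩

theorem continuous_pillowMap : Continuous pillowMap :=
  (continuous_orbit.comp continuous_rho).quotient_lift _

/-- The homeomorphism `ℙ → χ(T)` induced by `rho`. -/
def pillowHomeo : Pillowcase ≃ₜ CharVar π₁T :=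
  Continuous.homeoOfEquivCompactToT2 (f := Equiv.ofBijective pillowMap pillowMap_bijective)
    continuous_pillowMap

theorem pillowHomeo_proj (t : UTorus) : pillowHomeo (proj t) = orbit (rho t) := rfl

/-! ### Cocycles in a maximal torus -/

/-- The point of `𝕋` with the given angles. -/
def expPt (u : ℝ × ℝ) : UTorus := (Circle.exp u.1, Circle.exp u.2)

theorem coord_eq (u : ℝ × ℝ) : coord u = proj (expPt u) := rfl

/-- The real number by which the angle of `γ` changes along the tangent vector `u`. -/
def angle (γ : π₁T) : (ℝ × ℝ) →ₗ[ℝ] ℝ :=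
  (windFst γ : ℝ) • LinearMap.fst ℝ ℝ ℝ + (windSnd γ : ℝ) • LinearMap.snd ℝ ℝ ℝ

theorem angle_apply (γ : π₁T) (u : ℝ × ℝ) : angle γ u = windFst γ * u.1 + windSnd γ * u.2 := rfl

theorem angle_mu (u : ℝ × ℝ) : angle mu u = u.1 := by simp [angle_apply, wind_mu]

theorem angle_lam (u : ℝ × ℝ) : angle lam u = u.2 := by simp [angle_apply, wind_lam]

theorem angle_mul (γ δ : π₁T) (u : ℝ × ℝ) : angle (γ * δ) u = angle γ u + angle δ u := by
  simp only [angle_apply, windFst_mul, windSnd_mul]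
  push_cast
  ring

theorem rho_expPt (u : ℝ × ℝ) (γ : π₁T) :
    rho (expPt u) γ = circleToSU2 (Circle.exp (angle γ u)) := by
  rw [rho_apply, angle_apply, Circle.exp_add]
  congr 2
  · exact (Circle.exp_intCast_mul _ _).symm
  · exact (Circle.exp_intCast_mul _ _).symm

/-- The generator `i` of the Lie algebra of the maximal torus. -/
def ei : su2 := ⟨qi, qi_re⟩

/-- `φ` is the conjugate by `g` of the representation in the maximal torus with angles `u`. -/
def IsFrame (φ : RepSpace π₁T) (g : SU2) (u : ℝ × ℝ) : Prop :=
  ∀ γ, φ γ = g * rho (expPt u) γ * g⁻¹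

/-- The angles are not those of a central representation. -/
def IsNoncentral (u : ℝ × ℝ) : Prop := Real.sin u.1 ≠ 0 ∨ Real.sin u.2 ≠ 0

theorem Ad_rho_ei (u : ℝ × ℝ) (γ : π₁T) : Ad (rho (expPt u) γ) ei = ei := by
  apply Subtype.ext
  change (rho (expPt u) γ : ℍ[ℝ]) * qi * star (rho (expPt u) γ : ℍ[ℝ]) = qi
  rw [rho_expPt]
  have h : Commute (circleToSU2 (Circle.exp (angle γ u)) : ℍ[ℝ]) qi := by
    rw [coe_circleToSU2, axisPt]
    exact Commute.add_left (Quaternion.coe_commutes _ _) ((Commute.refl qi).smul_left _)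
  rw [h.eq, mul_assoc, (circleToSU2 _).2.2, mul_one]

theorem coe_rho_expPt (u : ℝ × ℝ) (γ : π₁T) : (rho (expPt u) γ : ℍ[ℝ])
    = (Real.cos (angle γ u) : ℍ[ℝ]) + Real.sin (angle γ u) • qi := by
  rw [rho_expPt, coe_circleToSU2, axisPt, Circle.coe_exp, Complex.exp_ofReal_mul_I_re,
    Complex.exp_ofReal_mul_I_im]

theorem coe_Ad (g : SU2) (v : su2) : ((Ad g v : su2) : ℍ[ℝ]) = g * v * star (g : ℍ[ℝ]) := rfl

theorem Ad_mul_apply (g h : SU2) (v : su2) : Ad (g * h) v = Ad g (Ad h v) := by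
  rw [map_mul, Module.End.mul_apply]

theorem Ad_inv_Ad (g : SU2) (v : su2) : Ad g⁻¹ (Ad g v) = v := by
  rw [← Ad_mul_apply, inv_mul_cancel, map_one, Module.End.one_apply]

theorem Ad_Ad_inv (g : SU2) (v : su2) : Ad g (Ad g⁻¹ v) = v := by
  rw [← Ad_mul_apply, mul_inv_cancel, map_one, Module.End.one_apply]

theorem pairing_ei (v : su2) : pairing ei v = (v : ℍ[ℝ]).imI := by
  rw [pairing_apply]
  simp [ei]

section Frame

variable {φ : RepSpace π₁T} {g : SU2} {u : ℝ × ℝ}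

theorem IsFrame.coe_apply (hf : IsFrame φ g u) (γ : π₁T) : (φ γ : ℍ[ℝ])
    = (Real.cos (angle γ u) : ℍ[ℝ]) + Real.sin (angle γ u) • ((Ad g ei : su2) : ℍ[ℝ]) := by
  have h : (g : ℍ[ℝ]) * star (g : ℍ[ℝ]) = 1 := g.2.2
  rw [hf γ, coe_conj, coe_rho_expPt, mul_add, add_mul, ← Quaternion.coe_commutes,
    mul_assoc _ (g : ℍ[ℝ]), h, mul_one, mul_smul_comm, smul_mul_assoc]
  rfl

theorem IsFrame.Ad_axis (hf : IsFrame φ g u) (γ : π₁T) : Ad (φ γ) (Ad g ei) = Ad g ei := by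
  rw [hf γ, Ad_mul_apply, Ad_inv_Ad, Ad_mul_apply, Ad_rho_ei]

theorem cocycle_mul (z : Z1 φ) (γ δ : π₁T) : z.1 (γ * δ) = Ad (φ γ) (z.1 δ) + z.1 γ :=
  (groupCohomology.mem_cocycles₁_iff (A := adRep φ) z.1).1 z.2 γ δ

/-- The cocycle obtained by varying the angles in the maximal torus. -/
def axisCocycle (hf : IsFrame φ g u) : (ℝ × ℝ) →ₗ[ℝ] Z1 φ where
  toFun v := ⟨fun γ => angle γ v • Ad g ei, by
    refine (groupCohomology.mem_cocycles₁_iff (A := adRep φ) _).2 fun γ δ => ?_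
    change angle (γ * δ) v • Ad g ei = Ad (φ γ) (angle δ v • Ad g ei) + angle γ v • Ad g ei
    rw [map_smul, hf.Ad_axis, angle_mul, add_smul, add_comm]⟩
  map_add' v w := by
    apply Subtype.ext
    funext γ
    change angle γ (v + w) • Ad g ei = angle γ v • Ad g ei + angle γ w • Ad g ei
    rw [map_add, add_smul]
  map_smul' c v := by
    apply Subtype.ext
    funext γ
    change angle γ (c • v) • Ad g ei = c • angle γ v • Ad g ei
    rw [map_smul, smul_assoc]

theorem axisCocycle_apply (hf : IsFrame φ g u) (v : ℝ × ℝ) (γ : π₁T) :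
    (axisCocycle hf v).1 γ = angle γ v • Ad g ei := rfl

theorem pairing_axis_self (g : SU2) : pairing (Ad g ei) (Ad g ei) = 1 := by
  rw [pairing_Ad, pairing_ei]
  rfl

/-- The component of a cocycle along the axis. -/
def axisComp (g : SU2) (z : Z1 φ) (γ : π₁T) : ℝ := pairing (Ad g ei) (z.1 γ)

/-- The axis is fixed by every `Ad (φ γ)` and the pairing is invariant, so the twist in the cocycle
identity disappears after pairing with the axis. -/
theorem axisComp_mul (hf : IsFrame φ g u) (z : Z1 φ) (γ δ : π₁T) :
    axisComp g z (γ * δ) = axisComp g z γ + axisComp g z δ := by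
  rw [axisComp, cocycle_mul, map_add, ← hf.Ad_axis γ, pairing_Ad, hf.Ad_axis γ, add_comm]
  rfl

theorem additive_eq (f : π₁T → ℝ) (hf : ∀ γ δ, f (γ * δ) = f γ + f δ) (γ : π₁T) :
    f γ = angle γ (f mu, f lam) := by
  let F : π₁T →* Multiplicative ℝ := MonoidHom.mk' (fun γ => Multiplicative.ofAdd (f γ))
    fun γ δ => by rw [hf, ofAdd_add]
  have h : ∀ (γ : π₁T) (n : ℤ), f (γ ^ n) = n * f γ := by
    intro γ n
    have h := congrArg Multiplicative.toAdd (map_zpow F γ n)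
    rw [toAdd_zpow, zsmul_eq_mul] at h
    exact h
  conv_lhs => rw [eq_mu_lam γ]
  rw [hf, h, h, angle_apply]

theorem axisComp_eq (hf : IsFrame φ g u) (z : Z1 φ) (γ : π₁T) :
    axisComp g z γ = angle γ (axisComp g z mu, axisComp g z lam) :=
  additive_eq _ (axisComp_mul hf z) γ

theorem axisComp_of_cls_eq_zero (hf : IsFrame φ g u) (z : Z1 φ) (hz : cls φ z = 0) (γ : π₁T) :
    axisComp g z γ = 0 := by
  obtain ⟨a, ha⟩ := (cls_eq_zero_iff φ z).1 hz
  rw [axisComp, ha, map_sub, ← hf.Ad_axis γ, pairing_Ad, hf.Ad_axis γ, sub_self]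

end Frame

/-- With `c = cos θ` and `s = sin θ`, `Ad A` rotates the `j`, `k` plane by `2θ`. As `s ≠ 0` this is
not the identity, and `Ad A - 1` is invertible there. -/
theorem exists_sub_eq {c s : ℝ} (hcs : c ^ 2 + s ^ 2 = 1) (hs : s ≠ 0) {A : SU2}
    (hA : (A : ℍ[ℝ]) = (c : ℍ[ℝ]) + s • qi) (v : su2) (hv : (v : ℍ[ℝ]).imI = 0) :
    ∃ a : su2, Ad A a - a = v := by
  have hv₀ : (v : ℍ[ℝ]).re = 0 := v.2
  set y := (v : ℍ[ℝ]).imJ with hy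
  set x := (v : ℍ[ℝ]).imK with hx
  -- In the complex coordinate `y + i x` on the plane this is `(y + i x) / (e^{2iθ} - 1)`, with `1 /
  -- (e^{2iθ} - 1) = -1/2 - i c / (2 s)`.
  let q : ℍ[ℝ] := ⟨0, 0, -y / 2 + c / (2 * s) * x, -x / 2 - c / (2 * s) * y⟩
  have e₀ : q.re = 0 := rfl
  have e₁ : q.imI = 0 := rfl
  have e₂ : q.imJ = -y / 2 + c / (2 * s) * x := rfl
  have e₃ : q.imK = -x / 2 - c / (2 * s) * y := rfl
  refine ⟨⟨q, e₀⟩, Subtype.ext ?_⟩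
  change (A : ℍ[ℝ]) * q * star (A : ℍ[ℝ]) - q = v
  rw [hA]
  ext
  · simp [e₀, e₁, e₂, e₃, hv₀]
  · simp [e₀, e₁, e₂, e₃, hv]
  · simp [e₀, e₁, e₂, e₃, ← hy]
    field_simp
    linear_combination (c * x + y * s) * hcs
  · simp [e₀, e₁, e₂, e₃, ← hx]
    field_simp
    linear_combination (s * x - c * y) * hcs

/-- The same rotation by `2θ`, being nontrivial, fixes no nonzero vector of the plane. -/
theorem eq_zero_of_Ad_eq {c s : ℝ} (hcs : c ^ 2 + s ^ 2 = 1) (hs : s ≠ 0) {A : SU2}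
    (hA : (A : ℍ[ℝ]) = (c : ℍ[ℝ]) + s • qi) (v : su2) (hv : (v : ℍ[ℝ]).imI = 0)
    (h : Ad A v = v) : v = 0 := by
  have hv₀ : (v : ℍ[ℝ]).re = 0 := v.2
  have h' : (A : ℍ[ℝ]) * v * star (A : ℍ[ℝ]) = v := congrArg Subtype.val h
  rw [hA] at h'
  have eJ := congrArg (fun x : ℍ[ℝ] => x.imJ) h'
  have eK := congrArg (fun x : ℍ[ℝ] => x.imK) h'
  simp [hv₀, hv] at eJ eK
  set y := (v : ℍ[ℝ]).imJ with hy
  set x := (v : ℍ[ℝ]).imK with hx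
  have f₁ : s * (s * y + c * x) = 0 := by linear_combination (-1 / 2) * eJ + y / 2 * hcs
  have f₂ : s * (c * y - s * x) = 0 := by linear_combination (1 / 2) * eK - x / 2 * hcs
  have g₁ := (mul_eq_zero.1 f₁).resolve_left hs
  have g₂ := (mul_eq_zero.1 f₂).resolve_left hs
  have hy0 : y = 0 := by linear_combination s * g₁ + c * g₂ - y * hcs
  have hx0 : x = 0 := by linear_combination c * g₁ - s * g₂ - x * hcs
  apply Subtype.ext
  ext
  · exact hv₀
  · exact hv
  · exact hy0
  · exact hx0

section Frame

variable {φ : RepSpace π₁T} {g : SU2} {u : ℝ × ℝ}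

/-- After conjugation into the maximal torus the cocycle takes values in the plane orthogonal to
`i`. Some `γ₀` acts there without fixed vectors, so a coboundary matches the cocycle at `γ₀`;
commutativity forces agreement at every other `γ`. -/
theorem cls_eq_zero_of_axisComp (hf : IsFrame φ g u) (hu : IsNoncentral u) (z : Z1 φ)
    (h₁ : axisComp g z mu = 0) (h₂ : axisComp g z lam = 0) : cls φ z = 0 := by
  have h0 (γ : π₁T) : axisComp g z γ = 0 := by
    rw [axisComp_eq hf, h₁, h₂]
    simp [angle_apply]
  obtain ⟨γ₀, hγ₀⟩ : ∃ γ, Real.sin (angle γ u) ≠ 0 := by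
    rcases hu with h | h
    · exact ⟨mu, by rwa [angle_mu]⟩
    · exact ⟨lam, by rwa [angle_lam]⟩
  let w : π₁T → su2 := fun γ => Ad g⁻¹ (z.1 γ)
  have hw0 (γ : π₁T) : (w γ : ℍ[ℝ]).imI = 0 := by
    rw [← pairing_ei, ← pairing_Ad g, Ad_Ad_inv]
    exact h0 γ
  have hw (γ δ : π₁T) : w (γ * δ) = Ad (rho (expPt u) γ) (w δ) + w γ := by
    simp only [w]
    rw [cocycle_mul, map_add, hf γ, Ad_mul_apply, Ad_mul_apply, Ad_inv_Ad]
  obtain ⟨a, ha⟩ := exists_sub_eq (Real.cos_sq_add_sin_sq _) hγ₀ (coe_rho_expPt u γ₀) (w γ₀)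
    (hw0 γ₀)
  have hAda (γ : π₁T) (a : su2) : ((Ad (rho (expPt u) γ) a - a : su2) : ℍ[ℝ]).imI = 0 := by
    rw [← pairing_ei, map_sub, ← Ad_rho_ei u γ, pairing_Ad, Ad_rho_ei, sub_self]
  have key (γ : π₁T) : w γ = Ad (rho (expPt u) γ) a - a := by
    rw [← sub_eq_zero]
    refine eq_zero_of_Ad_eq (Real.cos_sq_add_sin_sq _) hγ₀ (coe_rho_expPt u γ₀) _ ?_ ?_
    · have e₁ := hAda γ a
      have e₂ := hw0 γ
      rw [← pairing_ei] at e₁ e₂ ⊢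
      rw [map_sub, e₁, e₂, sub_self]
    -- Comparing the cocycle identity for `γ γ₀` and `γ₀ γ` shows that the difference at `γ` is
    -- fixed by `γ₀`.
    · have e₁ := hw γ γ₀
      rw [commute_pi1, hw, ← ha, map_sub] at e₁
      have e₂ : Ad (rho (expPt u) γ) (Ad (rho (expPt u) γ₀) a)
          = Ad (rho (expPt u) γ₀) (Ad (rho (expPt u) γ) a) := by
        rw [← Ad_mul_apply, ← Ad_mul_apply, ← map_mul, ← map_mul, commute_pi1]
      rw [e₂] at e₁
      rw [map_sub, map_sub, ← sub_eq_zero]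
      rw [← sub_eq_zero] at e₁
      rw [← e₁]
      abel
  refine (cls_eq_zero_iff φ z).2 ⟨Ad g a, fun γ => ?_⟩
  rw [← Ad_Ad_inv g (z.1 γ), hf γ, Ad_mul_apply, Ad_mul_apply, Ad_inv_Ad, ← map_sub]
  exact congrArg _ (key γ)

theorem axisComp_axisCocycle (hf : IsFrame φ g u) (v : ℝ × ℝ) (γ : π₁T) :
    axisComp g (axisCocycle hf v) γ = angle γ v := by
  rw [axisComp, axisCocycle_apply, map_smul, pairing_axis_self, smul_eq_mul, mul_one]

theorem cls_eq_of_axisComp (hf : IsFrame φ g u) (hu : IsNoncentral u) (z : Z1 φ) (v : ℝ × ℝ)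
    (h₁ : axisComp g z mu = v.1) (h₂ : axisComp g z lam = v.2) :
    cls φ z = cls φ (axisCocycle hf v) := by
  rw [← sub_eq_zero]
  refine (LinearMap.map_sub (cls φ) z (axisCocycle hf v)).symm.trans ?_
  have h (γ : π₁T) : axisComp g (z - axisCocycle hf v) γ = axisComp g z γ - angle γ v := by
    rw [← axisComp_axisCocycle hf v]
    exact map_sub (pairing (Ad g ei)) _ _
  refine cls_eq_zero_of_axisComp hf hu _ ?_ ?_
  · rw [h, h₁, angle_mu, sub_self]
  · rw [h, h₂, angle_lam, sub_self]

/-- The formal tangent space at a noncentral representation is identified with `ℝ²`. -/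
def tangentEquiv (hf : IsFrame φ g u) (hu : IsNoncentral u) : (ℝ × ℝ) ≃ₗ[ℝ] H1 φ :=
  LinearEquiv.ofBijective (cls φ ∘ₗ axisCocycle hf) (by
    constructor
    · refine (injective_iff_map_eq_zero _).2 fun v hv => ?_
      have h := axisComp_of_cls_eq_zero hf (axisCocycle hf v) hv
      refine Prod.ext ?_ ?_
      · have := h mu
        rwa [axisComp_axisCocycle, angle_mu] at this
      · have := h lam
        rwa [axisComp_axisCocycle, angle_lam] at this
    · intro x
      obtain ⟨z, rfl⟩ := cls_surjective φ x
      exact ⟨(axisComp g z mu, axisComp g z lam), (cls_eq_of_axisComp hf hu z _ rfl rfl).symm⟩)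

theorem tangentEquiv_apply (hf : IsFrame φ g u) (hu : IsNoncentral u) (v : ℝ × ℝ) :
    tangentEquiv hf hu v = cls φ (axisCocycle hf v) := rfl

/-- The axis is a unit vector fixed by the adjoint action, so the cup product on axis cocycles
reduces to the determinant of the two angle variations. -/
theorem omega_tangentEquiv (hf : IsFrame φ g u) (hu : IsNoncentral u) (v w : ℝ × ℝ) :
    omega φ (tangentEquiv hf hu v) (tangentEquiv hf hu w) = v.1 * w.2 - v.2 * w.1 := by
  rw [tangentEquiv_apply, tangentEquiv_apply, omega_cls, omegaZ_apply]
  simp only [axisCocycle_apply, map_smul, LinearMap.smul_apply, hf.Ad_axis, pairing_axis_self,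
    angle_mu, angle_lam, smul_eq_mul]
  ring

theorem finrank_of_noncentral (hf : IsFrame φ g u) (hu : IsNoncentral u) :
    Module.finrank ℝ (H1 φ) = 2 := by
  rw [← (tangentEquiv hf hu).finrank_eq]
  simp

end Frame

/-- The linear parametrization of `su(2)`. -/
def su2Param : (ℝ × ℝ × ℝ) →ₗ[ℝ] su2 where
  toFun p := ⟨⟨0, p.1, p.2.1, p.2.2⟩, rfl⟩
  map_add' p q := by
    apply Subtype.ext
    exact QuaternionAlgebra.ext (add_zero 0).symm rfl rfl rfl
  map_smul' c p := by
    apply Subtype.ext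
    exact QuaternionAlgebra.ext (mul_zero c).symm rfl rfl rfl

theorem su2Param_injective : Function.Injective su2Param := by
  intro p q h
  have h' := congrArg Subtype.val h
  exact Prod.ext (congrArg (fun x : ℍ[ℝ] => x.imI) h')
    (Prod.ext (congrArg (fun x : ℍ[ℝ] => x.imJ) h') (congrArg (fun x : ℍ[ℝ] => x.imK) h'))

/-- With trivial action there are no nonzero coboundaries, so sending `v` to the homomorphism `γ ↦
windFst γ • v` embeds the three-dimensional `su2` in `H1 φ`. -/
theorem finrank_ne_two_of_trivial {φ : RepSpace π₁T} (h : ∀ γ v, Ad (φ γ) v = v) :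
    Module.finrank ℝ (H1 φ) ≠ 2 := by
  intro hd
  -- `finrank` is `0` on infinite-dimensional spaces, so the value `2` supplies the finiteness
  -- needed to compare ranks.
  have : Module.Finite ℝ (H1 φ) := Module.finite_of_finrank_pos (by omega)
  let F : su2 →ₗ[ℝ] Z1 φ :=
    { toFun := fun v => ⟨fun γ => (windFst γ : ℝ) • v, by
        refine (groupCohomology.mem_cocycles₁_iff (A := adRep φ) _).2 fun γ δ => ?_
        change (windFst (γ * δ) : ℝ) • v = Ad (φ γ) ((windFst δ : ℝ) • v) + (windFst γ : ℝ) • v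
        rw [h, windFst_mul, Int.cast_add, add_smul, add_comm]⟩
      map_add' := fun v w => by
        apply Subtype.ext
        funext γ
        exact smul_add _ v w
      map_smul' := fun c v => by
        apply Subtype.ext
        funext γ
        exact smul_comm _ c v }
  have hF : Function.Injective (cls φ ∘ₗ F ∘ₗ su2Param) := by
    refine (injective_iff_map_eq_zero _).2 fun p hp => ?_
    obtain ⟨a, ha⟩ := (cls_eq_zero_iff φ (F (su2Param p))).1 hp
    have h₁ : (windFst mu : ℝ) • su2Param p = 0 := by
      have := ha mu
      rwa [h, sub_self] at this
    rw [wind_mu.1, Int.cast_one, one_smul] at h₁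
    exact su2Param_injective (h₁.trans (map_zero _).symm)
  have hle := LinearMap.finrank_le_finrank_of_injective hF
  rw [hd] at hle
  simp at hle

/-! ### The top stratum -/

theorem exists_expPt (t : UTorus) : ∃ u, expPt u = t :=
  ⟨(Complex.arg t.1, Complex.arg t.2), Prod.ext (Circle.exp_arg t.1) (Circle.exp_arg t.2)⟩

theorem exists_frame {φ : RepSpace π₁T} {u : ℝ × ℝ} (h : orbit φ = pillowHomeo (coord u)) :
    ∃ g, IsFrame φ g u :=
  (orbit_eq_iff _ _).1 h.symm

theorem orbit_of_frame {φ : RepSpace π₁T} {g : SU2} {u : ℝ × ℝ} (h : IsFrame φ g u) :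
    orbit φ = pillowHomeo (coord u) :=
  ((orbit_eq_iff _ _).2 ⟨g, h⟩).symm

theorem exists_coord (x : Pillowcase) : ∃ u, coord u = x := by
  induction x using Quotient.inductionOn with
  | h t =>
    obtain ⟨u, rfl⟩ := exists_expPt t
    exact ⟨u, rfl⟩

theorem circle_exp_inv_eq_iff (x : ℝ) : (Circle.exp x)⁻¹ = Circle.exp x ↔ Real.sin x = 0 := by
  have him (y : ℝ) : ((Circle.exp y : Circle) : ℂ).im = Real.sin y := by
    rw [Circle.coe_exp, Complex.exp_ofReal_mul_I_im]
  have hre (y : ℝ) : ((Circle.exp y : Circle) : ℂ).re = Real.cos y := by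
    rw [Circle.coe_exp, Complex.exp_ofReal_mul_I_re]
  constructor
  · intro h
    have e := congrArg (fun z : Circle => (z : ℂ).im) h
    simp only [Circle.coe_inv_eq_conj, Complex.conj_im, him] at e
    linarith
  · intro h
    refine circle_ext ?_ ?_
    · rw [Circle.coe_inv_eq_conj, Complex.conj_re]
    · rw [Circle.coe_inv_eq_conj, Complex.conj_im, him, h, neg_zero]

theorem mem_pillowStar_proj (t : UTorus) : proj t ∈ pillowStar ↔ t⁻¹ ≠ t := by
  constructor
  · rintro ⟨t', ht', h⟩
    rcases Quotient.exact (s := ellipticSetoid) h with e | e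
    · rw [e]
      exact ht'
    · rw [e, inv_inv]
      exact ht'.symm
  · exact fun h => ⟨t, h, rfl⟩

theorem coord_mem_pillowStar (u : ℝ × ℝ) : coord u ∈ pillowStar ↔ IsNoncentral u := by
  rw [coord_eq, mem_pillowStar_proj, Ne, Prod.ext_iff, IsNoncentral, ← not_and_or]
  exact not_congr (and_congr (circle_exp_inv_eq_iff _) (circle_exp_inv_eq_iff _))

theorem continuous_coord : Continuous coord :=
  continuous_quotient_mk'.comp (by fun_prop)

theorem isOpen_pillowStar : IsOpen pillowStar := by
  have hq : Topology.IsQuotientMap proj := isQuotientMap_quot_mk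
  rw [← hq.isOpen_preimage]
  have : proj ⁻¹' pillowStar = {t : UTorus | t⁻¹ ≠ t} := Set.ext mem_pillowStar_proj
  rw [this]
  exact isOpen_ne_fun continuous_inv continuous_id

theorem Ad_of_central {φ : RepSpace π₁T} {g : SU2} {u : ℝ × ℝ} (hf : IsFrame φ g u)
    (hu : ¬ IsNoncentral u) (γ : π₁T) (v : su2) : Ad (φ γ) v = v := by
  have hs : Real.sin (angle γ u) = 0 := by
    simp only [IsNoncentral, not_or, not_not] at hu
    obtain ⟨m, hm⟩ := Real.sin_eq_zero_iff.1 hu.1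
    obtain ⟨n, hn⟩ := Real.sin_eq_zero_iff.1 hu.2
    refine Real.sin_eq_zero_iff.2 ⟨windFst γ * m + windSnd γ * n, ?_⟩
    rw [angle_apply, ← hm, ← hn]
    push_cast
    ring
  apply Subtype.ext
  have h : (φ γ : ℍ[ℝ]) = (Real.cos (angle γ u) : ℍ[ℝ]) := by
    rw [hf.coe_apply, hs, zero_smul, add_zero]
  have h' : (φ γ : ℍ[ℝ]) * star (φ γ : ℍ[ℝ]) = 1 := (φ γ).2.2
  rw [coe_Ad]
  rw [show (φ γ : ℍ[ℝ]) * v = v * (φ γ : ℍ[ℝ]) by rw [h, Quaternion.coe_commutes], mul_assoc, h',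
    mul_one]

/-- If `sin u.1 = 0`, then `sin (u.1 + s) = cos u.1 * sin s` is nonzero for small `s > 0`. -/
theorem exists_noncentral_near (u : ℝ × ℝ) (U : Set (ℝ × ℝ)) (hU : U ∈ 𝓝 u) :
    ∃ u' ∈ U, IsNoncentral u' := by
  by_cases hu : IsNoncentral u
  · exact ⟨u, mem_of_mem_nhds hU, hu⟩
  have h0 : Real.sin u.1 = 0 := by
    simp only [IsNoncentral, not_or, not_not] at hu
    exact hu.1
  have hc : Filter.Tendsto (fun s : ℝ => (u.1 + s, u.2)) (𝓝[>] 0) (𝓝 u) := by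
    have : Continuous fun s : ℝ => (u.1 + s, u.2) := by fun_prop
    have h := this.tendsto 0
    rw [add_zero] at h
    exact h.mono_left nhdsWithin_le_nhds
  have h₁ := hc hU
  have h₂ : Set.Ioo (0 : ℝ) Real.pi ∈ 𝓝[>] (0 : ℝ) := Ioo_mem_nhdsGT Real.pi_pos
  obtain ⟨s, hs₁, hs₂⟩ := (Filter.inter_mem h₁ h₂ : _ ∈ 𝓝[>] (0 : ℝ)) |> Filter.nonempty_of_mem
  refine ⟨_, hs₁, Or.inl ?_⟩
  change Real.sin (u.1 + s) ≠ 0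
  rw [Real.sin_add, h0, zero_mul, zero_add]
  refine mul_ne_zero ?_ (Real.sin_pos_of_pos_of_lt_pi hs₂.1 hs₂.2).ne'
  intro h
  have := Real.sin_sq_add_cos_sq u.1
  rw [h0, h] at this
  norm_num at this

theorem finrank_eq_two_iff {φ : RepSpace π₁T} {g : SU2} {u : ℝ × ℝ} (hf : IsFrame φ g u) :
    Module.finrank ℝ (H1 φ) = 2 ↔ IsNoncentral u := by
  refine ⟨fun h => ?_, finrank_of_noncentral hf⟩
  by_contra hu
  exact finrank_ne_two_of_trivial (Ad_of_central hf hu) h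

/-- The dimension of the tangent space is 2 exactly at noncentral points. These form an open set,
and every neighbourhood of a central point meets it, so the dimension jumps precisely at the central
points. -/
theorem pillowHomeo_mem_topStratum (x : Pillowcase) :
    pillowHomeo x ∈ topStratum π₁T ↔ x ∈ pillowStar := by
  constructor
  · rintro ⟨U, hU, d, hd⟩
    obtain ⟨u, rfl⟩ := exists_coord x
    have hU' : (fun u => pillowHomeo (coord u)) ⁻¹' U ∈ 𝓝 u :=
      (pillowHomeo.continuous.comp continuous_coord).continuousAt hU
    obtain ⟨u', hu', hn⟩ := exists_noncentral_near u _ hU'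
    have hframe (u : ℝ × ℝ) : IsFrame (rho (expPt u)) 1 u := fun γ => by simp
    have h₁ := hd (rho (expPt u')) hu'
    rw [(finrank_eq_two_iff (hframe u')).2 hn] at h₁
    have h₂ := hd (rho (expPt u)) (mem_of_mem_nhds hU)
    rw [← h₁] at h₂
    exact (coord_mem_pillowStar u).2 ((finrank_eq_two_iff (hframe u)).1 h₂)
  · intro hx
    refine ⟨pillowHomeo '' pillowStar, ?_, 2, ?_⟩
    · exact (pillowHomeo.isOpenMap _ isOpen_pillowStar).mem_nhds ⟨x, hx, rfl⟩
    · rintro φ ⟨y, hy, e⟩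
      obtain ⟨u, rfl⟩ := exists_coord y
      obtain ⟨g, hg⟩ := exists_frame e.symm
      exact (finrank_eq_two_iff hg).2 ((coord_mem_pillowStar u).1 hy)

theorem image_pillowStar : pillowHomeo '' pillowStar = topStratum π₁T := by
  ext y
  obtain ⟨x, rfl⟩ := pillowHomeo.surjective y
  rw [pillowHomeo.injective.mem_set_image, pillowHomeo_mem_topStratum]

/-! ### The Dehn twists preserve the form -/

/-- Expanding the cocycles at `mu * lam` produces extra terms with first entry `z mu`. They combine
to the original form by the relation `e`, which is the cocycle identity for `mu * lam = lam * mu`.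
-/
theorem preservesFormalForm_dehnMu : PreservesFormalForm dehnMuHom := by
  intro φ z w z' w' hz hw
  rw [omega_cls, omega_cls, omegaZ_apply, omegaZ_apply, hz, hz, hw, hw]
  change pairing (z.1 (dehnMuHom mu)) (Ad (φ (dehnMuHom mu)) (w.1 (dehnMuHom lam)))
    - pairing (z.1 (dehnMuHom lam)) (Ad (φ (dehnMuHom lam)) (w.1 (dehnMuHom mu))) = _
  rw [dehnMuHom_mu, dehnMuHom_lam, map_mul]
  have e : Ad (φ mu) (w.1 lam) + w.1 mu = Ad (φ lam) (w.1 mu) + w.1 lam := by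
    rw [← cocycle_mul, ← cocycle_mul, mu_mul_lam]
  have e' := congrArg (fun v => pairing (z.1 mu) (Ad (φ mu) v)) e
  simp only [map_add] at e'
  rw [cocycle_mul z, cocycle_mul w, Ad_mul_apply]
  simp only [map_add, LinearMap.add_apply, pairing_Ad]
  linarith

theorem preservesFormalForm_dehnLam : PreservesFormalForm dehnLamHom := by
  intro φ z w z' w' hz hw
  rw [omega_cls, omega_cls, omegaZ_apply, omegaZ_apply, hz, hz, hw, hw]
  change pairing (z.1 (dehnLamHom mu)) (Ad (φ (dehnLamHom mu)) (w.1 (dehnLamHom lam)))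
    - pairing (z.1 (dehnLamHom lam)) (Ad (φ (dehnLamHom lam)) (w.1 (dehnLamHom mu))) = _
  rw [dehnLamHom_mu, dehnLamHom_lam]
  -- With `ν` for `mu * lam⁻¹`, the twisted form is evaluated on `ν`, `lam` and the original one on
  -- `lam * ν`, `lam`. No cocycle has to be expanded at an inverse, and the argument for `D_μ`
  -- applies.
  have hmu : mu = lam * (mu * lam⁻¹) := by rw [commute_pi1 mu, mul_inv_cancel_left]
  generalize mu * lam⁻¹ = ν at hmu ⊢
  have e : Ad (φ lam) (w.1 ν) + w.1 lam = Ad (φ ν) (w.1 lam) + w.1 ν := by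
    rw [← cocycle_mul, ← cocycle_mul, commute_pi1]
  have e' := congrArg (fun v => pairing (z.1 lam) (Ad (φ lam) v)) e
  simp only [map_add] at e'
  rw [hmu, cocycle_mul z, cocycle_mul w, map_mul, Ad_mul_apply]
  simp only [map_add, LinearMap.add_apply, pairing_Ad]
  linarith

/-! ### The action of `PSL(2, ℤ)` -/

theorem continuous_slAct (A : SL2Z) : Continuous (slAct A) := by
  unfold slAct
  fun_prop

theorem continuous_smul_pillow (g : PSL2Z) : Continuous fun x : Pillowcase => g • x := by
  induction g using QuotientGroup.induction_on with
  | H A => exact (continuous_quotient_mk'.comp (continuous_slAct A)).quotient_lift _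

/-- The action of `PSL(2, ℤ)` on the pillowcase by homeomorphisms. -/
def pillowAction : PSL2Z →* (Pillowcase ≃ₜ Pillowcase) where
  toFun g :=
    { toFun := fun x => g • x
      invFun := fun x => g⁻¹ • x
      left_inv := fun x => inv_smul_smul g x
      right_inv := fun x => smul_inv_smul g x
      continuous_toFun := continuous_smul_pillow g
      continuous_invFun := continuous_smul_pillow g⁻¹ }
  map_one' := Homeomorph.ext fun x => one_smul PSL2Z x
  map_mul' g h := Homeomorph.ext fun x => mul_smul g h x

/-- The action of `PSL(2, ℤ)` on the character variety by homeomorphisms. -/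
def charAction : PSL2Z →* (CharVar π₁T ≃ₜ CharVar π₁T) where
  toFun g := (pillowHomeo.symm.trans (pillowAction g)).trans pillowHomeo
  map_one' := Homeomorph.ext fun x => by
    simp [map_one]
  map_mul' g h := Homeomorph.ext fun x => by
    simp [map_mul]

theorem charAction_pillowHomeo (g : PSL2Z) (x : Pillowcase) :
    charAction g (pillowHomeo x) = pillowHomeo (g • x) := by
  change pillowHomeo (g • pillowHomeo.symm (pillowHomeo x)) = _
  rw [pillowHomeo.symm_apply_apply]

/-- `rho (z, w)` precomposed with the twist takes the values `z` and `z w` on the generators, which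
matches the rows `(1, 0)` and `(1, 1)`. -/
theorem charAction_matMu (x : CharVar π₁T) : charAction matMu x = pullback dehnMuHom x := by
  obtain ⟨y, rfl⟩ := pillowHomeo.surjective x
  rw [charAction_pillowHomeo]
  induction y using Quotient.inductionOn with
  | h t =>
    change orbit (rho (slAct _ t)) = orbit (RepSpace.precomp dehnMuHom (rho t))
    congr 1
    symm
    rw [eq_rho_iff]
    change rho t (dehnMuHom mu) = _ ∧ rho t (dehnMuHom lam) = _
    rw [dehnMuHom_mu, dehnMuHom_lam, rho_apply, rho_apply, windFst_mul, windSnd_mul]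
    simp [slAct, wind_mu, wind_lam]

theorem charAction_matLam (x : CharVar π₁T) : charAction matLam x = pullback dehnLamHom x := by
  obtain ⟨y, rfl⟩ := pillowHomeo.surjective x
  rw [charAction_pillowHomeo]
  induction y using Quotient.inductionOn with
  | h t =>
    change orbit (rho (slAct _ t)) = orbit (RepSpace.precomp dehnLamHom (rho t))
    congr 1
    symm
    rw [eq_rho_iff]
    change rho t (dehnLamHom mu) = _ ∧ rho t (dehnLamHom lam) = _
    rw [dehnLamHom_mu, dehnLamHom_lam, rho_apply, rho_apply, ← zpow_neg_one lam, windFst_mul,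
      windSnd_mul, windFst_zpow, windSnd_zpow]
    simp [slAct, wind_mu, wind_lam]

/-- The matrix with rows `(1, 0)` and `(1, 1)`. -/
def slMu : SL2Z := ⟨!![1, 0; 1, 1], by simp⟩

/-- The matrix with rows `(1, -1)` and `(0, 1)`. -/
def slLam : SL2Z := ⟨!![1, -1; 0, 1], by simp⟩

theorem T_eq : ModularGroup.T = slLam⁻¹ := by decide

theorem S_eq : ModularGroup.S = slLam * slMu * slLam := by decide

/-- The standard generators `S` and `T` of `SL(2, ℤ)` are words in the two matrices. -/
theorem closure_slMu_slLam : Subgroup.closure {slMu, slLam} = ⊤ := by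
  have h₁ : slMu ∈ Subgroup.closure {slMu, slLam} := Subgroup.subset_closure (by simp)
  have h₂ : slLam ∈ Subgroup.closure {slMu, slLam} := Subgroup.subset_closure (by simp)
  rw [eq_top_iff, ← SpecialLinearGroup.SL2Z_generators, Subgroup.closure_le]
  rintro _ (rfl | rfl)
  · rw [S_eq]
    exact mul_mem (mul_mem h₂ h₁) h₂
  · rw [T_eq]
    exact inv_mem h₂

theorem closure_matMu_matLam : Subgroup.closure {matMu, matLam} = ⊤ := by
  rw [eq_top_iff]
  intro g _
  induction g using QuotientGroup.induction_on with
  | H A =>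
    have h := Subgroup.mem_map_of_mem (QuotientGroup.mk' (Subgroup.center SL2Z))
      (Subgroup.mem_top A)
    rw [← closure_slMu_slLam, MonoidHom.map_closure, Set.image_pair] at h
    exact h

theorem eq_charAction_iff (b : PSL2Z →* (CharVar π₁T ≃ₜ CharVar π₁T)) :
    ((∀ x, b matMu x = pullback dehnMuHom x) ∧ (∀ x, b matLam x = pullback dehnLamHom x)) ↔
      b = charAction := by
  constructor
  · rintro ⟨h₁, h₂⟩
    refine MonoidHom.eq_of_eqOn_dense closure_matMu_matLam ?_
    rintro _ (rfl | rfl)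
    · exact Homeomorph.ext fun x => (h₁ x).trans (charAction_matMu x).symm
    · exact Homeomorph.ext fun x => (h₂ x).trans (charAction_matLam x).symm
  · rintro rfl
    exact ⟨charAction_matMu, charAction_matLam⟩

theorem range_charAction :
    charAction.range = Subgroup.closure {charAction matMu, charAction matLam} := by
  rw [MonoidHom.range_eq_map, ← closure_matMu_matLam, MonoidHom.map_closure, Set.image_pair]

/-- A coincidence with `m ≠ n` would give `π = (m - n) / (2 k)` with `k ≠ 0`, contradicting
irrationality of `π`. -/
theorem circle_zpow_exp_one {m n : ℤ} (h : Circle.exp (m : ℝ) = Circle.exp (n : ℝ)) : m = n := by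
  obtain ⟨k, hk⟩ := Circle.exp_eq_exp.1 h
  rcases eq_or_ne k 0 with rfl | hk0
  · simpa using hk
  · exfalso
    refine irrational_pi ⟨((m - n : ℤ) : ℚ) / ((2 * k : ℤ) : ℚ), ?_⟩
    have : (k : ℝ) ≠ 0 := Int.cast_ne_zero.2 hk0
    push_cast
    field_simp
    linarith

theorem charAction_injective : Function.Injective charAction := by
  refine (injective_iff_map_eq_one _).2 fun g hg => ?_
  induction g using QuotientGroup.induction_on with
  | H A =>
    have key (t : UTorus) : slAct A t = t ∨ slAct A t = t⁻¹ := by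
      have h := congrArg (fun f : CharVar π₁T ≃ₜ CharVar π₁T => f (pillowHomeo (proj t))) hg
      change charAction _ (pillowHomeo (proj t)) = pillowHomeo (proj t) at h
      rw [charAction_pillowHomeo] at h
      exact Quotient.exact (s := ellipticSetoid) (pillowHomeo.injective h).symm
    have hexp (n : ℤ) : Circle.exp 1 ^ n = Circle.exp (n : ℝ) := by
      rw [← Circle.exp_intCast_mul, mul_one]
    have h0 : (1 : Circle) = Circle.exp ((0 : ℤ) : ℝ) := by simp
    have h1 : Circle.exp 1 = Circle.exp ((1 : ℤ) : ℝ) := by simp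
    have h1' : (Circle.exp 1)⁻¹ = Circle.exp ((-1 : ℤ) : ℝ) := by simp
    -- The test point `(e^i, 1)` reads off the first column of `A` up to sign; `(1, e^i)` then gives
    -- the upper right entry, and the determinant gives the last one.
    have hA : (A.1 0 0 = 1 ∨ A.1 0 0 = -1) ∧ A.1 1 0 = 0 := by
      rcases key (Circle.exp 1, 1) with h | h
      · have e₁ := congrArg Prod.fst h
        have e₂ := congrArg Prod.snd h
        simp only [slAct, one_zpow, mul_one, hexp] at e₁ e₂
        exact ⟨Or.inl (circle_zpow_exp_one (e₁.trans h1)), circle_zpow_exp_one (e₂.trans h0)⟩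
      · have e₁ := congrArg Prod.fst h
        have e₂ := congrArg Prod.snd h
        simp only [slAct, one_zpow, mul_one, hexp, Prod.fst_inv, Prod.snd_inv, inv_one] at e₁ e₂
        exact ⟨Or.inr (circle_zpow_exp_one (e₁.trans h1')), circle_zpow_exp_one (e₂.trans h0)⟩
    have hA' : A.1 0 1 = 0 := by
      rcases key (1, Circle.exp 1) with h | h
      · have e₁ := congrArg Prod.fst h
        simp only [slAct, one_zpow, one_mul, hexp] at e₁
        exact circle_zpow_exp_one (e₁.trans h0)
      · have e₁ := congrArg Prod.fst h
        simp only [slAct, one_zpow, one_mul, hexp, Prod.fst_inv, inv_one] at e₁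
        exact circle_zpow_exp_one (e₁.trans h0)
    have hdet : A.1 0 0 * A.1 1 1 = 1 := by
      have := A.2
      rw [Matrix.det_fin_two, hA', zero_mul, sub_zero] at this
      exact this
    refine (QuotientGroup.eq_one_iff A).2 ?_
    refine Matrix.SpecialLinearGroup.mem_center_iff.2 ⟨A.1 0 0, ?_, ?_⟩
    · rw [Fintype.card_fin]
      rcases hA.1 with h | h <;> rw [h] <;> norm_num
    · have h11 : A.1 1 1 = A.1 0 0 := by
        rcases hA.1 with h | h <;> rw [h] at hdet ⊢ <;> linarith
      ext i j
      rw [Matrix.scalar_apply]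
      fin_cases i <;> fin_cases j <;> simp [hA', hA.2, h11]

/-! ### Smooth local angle coordinates -/

theorem contDiff_re : ContDiff ℝ ∞ fun q : ℍ[ℝ] => q.re :=
  (LinearMap.toContinuousLinearMap
    ({ toFun := fun q => q.re, map_add' := by simp, map_smul' := by simp } : ℍ[ℝ] →ₗ[ℝ] ℝ)).contDiff

theorem contDiff_imI : ContDiff ℝ ∞ fun q : ℍ[ℝ] => q.imI :=
  (LinearMap.toContinuousLinearMap
    ({ toFun := fun q => q.imI, map_add' := by simp, map_smul' := by simp } :
      ℍ[ℝ] →ₗ[ℝ] ℝ)).contDiff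

theorem contDiff_imJ : ContDiff ℝ ∞ fun q : ℍ[ℝ] => q.imJ :=
  (LinearMap.toContinuousLinearMap
    ({ toFun := fun q => q.imJ, map_add' := by simp, map_smul' := by simp } :
      ℍ[ℝ] →ₗ[ℝ] ℝ)).contDiff

theorem contDiff_imK : ContDiff ℝ ∞ fun q : ℍ[ℝ] => q.imK :=
  (LinearMap.toContinuousLinearMap
    ({ toFun := fun q => q.imK, map_add' := by simp, map_smul' := by simp } :
      ℍ[ℝ] →ₗ[ℝ] ℝ)).contDiff

theorem contDiff_im : ContDiff ℝ ∞ fun q : ℍ[ℝ] => q.im :=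
  (LinearMap.toContinuousLinearMap
    ({ toFun := fun q => q.im, map_add' := by simp, map_smul' := by simp } :
      ℍ[ℝ] →ₗ[ℝ] ℍ[ℝ])).contDiff

/-- A combination of the imaginary parts of two quaternions, whose direction is an axis for
commuting unit quaternions with angles near `u`. -/
def axisVec (u : ℝ × ℝ) (p : ℍ[ℝ] × ℍ[ℝ]) : ℍ[ℝ] :=
  Real.sin u.1 • p.1.im + Real.sin u.2 • p.2.im

/-- The normalization of `axisVec`. -/
def axisDir (u : ℝ × ℝ) (p : ℍ[ℝ] × ℍ[ℝ]) : ℍ[ℝ] := ‖axisVec u p‖⁻¹ • axisVec u p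

/-- The real part of `axisProj h A * e^{-iθ}`. -/
def relRe (θ : ℝ) (h A : ℍ[ℝ]) : ℝ :=
  (axisProj h A).re * Real.cos θ + (axisProj h A).im * Real.sin θ

/-- The imaginary part of `axisProj h A * e^{-iθ}`. -/
def relIm (θ : ℝ) (h A : ℍ[ℝ]) : ℝ :=
  (axisProj h A).im * Real.cos θ - (axisProj h A).re * Real.sin θ

/-- The angles, near `u`, of a pair of commuting unit quaternions. -/
def locCoord (u : ℝ × ℝ) (p : ℍ[ℝ] × ℍ[ℝ]) : ℝ × ℝ :=
  (u.1 + Real.arctan (relIm u.1 (axisDir u p) p.1 / relRe u.1 (axisDir u p) p.1),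
    u.2 + Real.arctan (relIm u.2 (axisDir u p) p.2 / relRe u.2 (axisDir u p) p.2))

/-- The set on which `locCoord` is a smooth coordinate. -/
def locDomain (u : ℝ × ℝ) : Set (ℍ[ℝ] × ℍ[ℝ]) :=
  {p | axisVec u p ≠ 0 ∧ 0 < relRe u.1 (axisDir u p) p.1 ∧ 0 < relRe u.2 (axisDir u p) p.2}

theorem contDiff_axisVec (u : ℝ × ℝ) : ContDiff ℝ ∞ (axisVec u) :=
  ((contDiff_im.comp contDiff_fst).const_smul (Real.sin u.1)).add
    ((contDiff_im.comp contDiff_snd).const_smul (Real.sin u.2))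

theorem contDiffAt_axisDir {u : ℝ × ℝ} {p : ℍ[ℝ] × ℍ[ℝ]} (hp : axisVec u p ≠ 0) :
    ContDiffAt ℝ ∞ (axisDir u) p := by
  have h := (contDiff_axisVec u).contDiffAt (x := p)
  exact ((h.norm ℝ hp).inv (norm_ne_zero_iff.2 hp)).smul h

theorem contDiff_axisProj_im :
    ContDiff ℝ ∞ fun p : ℍ[ℝ] × ℍ[ℝ] => (axisProj p.1 p.2).im := by
  unfold axisProj
  have h₁ := contDiff_imI
  have h₂ := contDiff_imJ
  have h₃ := contDiff_imK
  exact (((h₁.comp contDiff_snd).mul (h₁.comp contDiff_fst)).add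
    ((h₂.comp contDiff_snd).mul (h₂.comp contDiff_fst))).add
    ((h₃.comp contDiff_snd).mul (h₃.comp contDiff_fst))

theorem contDiff_relRe (θ : ℝ) : ContDiff ℝ ∞ fun p : ℍ[ℝ] × ℍ[ℝ] => relRe θ p.1 p.2 :=
  ((contDiff_re.comp contDiff_snd).mul contDiff_const).add
    (contDiff_axisProj_im.mul contDiff_const)

theorem contDiff_relIm (θ : ℝ) : ContDiff ℝ ∞ fun p : ℍ[ℝ] × ℍ[ℝ] => relIm θ p.1 p.2 :=
  (contDiff_axisProj_im.mul contDiff_const).sub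
    ((contDiff_re.comp contDiff_snd).mul contDiff_const)

theorem contDiffAt_locCoord {u : ℝ × ℝ} {p : ℍ[ℝ] × ℍ[ℝ]} (hp : p ∈ locDomain u) :
    ContDiffAt ℝ ∞ (locCoord u) p := by
  have h := contDiffAt_axisDir hp.1
  have e₁ : ContDiffAt ℝ ∞ (fun p => (axisDir u p, p.1)) p := h.prodMk contDiffAt_fst
  have e₂ : ContDiffAt ℝ ∞ (fun p => (axisDir u p, p.2)) p := h.prodMk contDiffAt_snd
  refine ContDiffAt.prodMk ?_ ?_
  · exact contDiffAt_const.add (Real.contDiff_arctan.contDiffAt.comp p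
      (((contDiff_relIm u.1).contDiffAt.comp p e₁).div
        ((contDiff_relRe u.1).contDiffAt.comp p e₁) hp.2.1.ne'))
  · exact contDiffAt_const.add (Real.contDiff_arctan.contDiffAt.comp p
      (((contDiff_relIm u.2).contDiffAt.comp p e₂).div
        ((contDiff_relRe u.2).contDiffAt.comp p e₂) hp.2.2.ne'))

theorem locDomain_mem_nhds {u : ℝ × ℝ} {p : ℍ[ℝ] × ℍ[ℝ]} (hp : p ∈ locDomain u) :
    locDomain u ∈ 𝓝 p := by
  have h := contDiffAt_axisDir hp.1
  have e₁ : ContDiffAt ℝ ∞ (fun p => (axisDir u p, p.1)) p := h.prodMk contDiffAt_fst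
  have e₂ : ContDiffAt ℝ ∞ (fun p => (axisDir u p, p.2)) p := h.prodMk contDiffAt_snd
  have f₁ := ((contDiff_relRe u.1).contDiffAt.comp p e₁).continuousAt
  have f₂ := ((contDiff_relRe u.2).contDiffAt.comp p e₂).continuousAt
  filter_upwards [(contDiff_axisVec u).continuous.continuousAt.eventually_ne hp.1,
    f₁.eventually (lt_mem_nhds hp.2.1), f₂.eventually (lt_mem_nhds hp.2.2)] with q h₁ h₂ h₃
  exact ⟨h₁, h₂, h₃⟩

/-- The point `z e^{-iθ}` of the circle has positive real part, so its argument is the arctangent of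
imaginary part over real part. -/
theorem circle_eq_exp_arctan {θ : ℝ} {h A : ℍ[ℝ]} {z : Circle} (hz : (z : ℂ) = axisProj h A)
    (hpos : 0 < relRe θ h A) : z = Circle.exp (θ + Real.arctan (relIm θ h A / relRe θ h A)) := by
  have hsq : relRe θ h A ^ 2 + relIm θ h A ^ 2 = 1 := by
    have h₁ := circle_sq z
    have h₂ := Real.cos_sq_add_sin_sq θ
    rw [relRe, relIm, ← hz]
    linear_combination (Real.cos θ ^ 2 + Real.sin θ ^ 2) * h₁ + h₂
  have hs : √(1 + (relIm θ h A / relRe θ h A) ^ 2) = (relRe θ h A)⁻¹ := by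
    rw [Real.sqrt_eq_iff_mul_self_eq (by positivity) (by positivity)]
    field_simp
    linarith
  have hc : Real.cos (Real.arctan (relIm θ h A / relRe θ h A)) = relRe θ h A := by
    rw [Real.cos_arctan, hs, one_div, inv_inv]
  have hs' : Real.sin (Real.arctan (relIm θ h A / relRe θ h A)) = relIm θ h A := by
    rw [Real.sin_arctan, hs]
    field_simp
  have h₂ := Real.cos_sq_add_sin_sq θ
  refine circle_ext ?_ ?_
  · rw [Circle.coe_exp, Complex.exp_ofReal_mul_I_re, Real.cos_add, hc, hs', relRe, relIm, hz]
    linear_combination (-(axisProj h A).re) * h₂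
  · rw [Circle.coe_exp, Complex.exp_ofReal_mul_I_im, Real.sin_add, hc, hs', relRe, relIm, hz]
    linear_combination (-(axisProj h A).im) * h₂

/-- The pair of values of a representation on the generators. -/
def genPair (ψ : RepSpace π₁T) : ℍ[ℝ] × ℍ[ℝ] := ((ψ mu : ℍ[ℝ]), (ψ lam : ℍ[ℝ]))

theorem continuous_genPair : Continuous genPair :=
  (continuous_subtype_val.comp (continuous_eval mu)).prodMk
    (continuous_subtype_val.comp (continuous_eval lam))

/-- `axisDir` is built from imaginary parts of commuting values, so it commutes with both
generators' values and is a common axis. The angles along it are those computed by `locCoord`. -/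
theorem orbit_eq_locCoord {u : ℝ × ℝ} {ψ : RepSpace π₁T} (h : genPair ψ ∈ locDomain u) :
    orbit ψ = pillowHomeo (coord (locCoord u (genPair ψ))) := by
  have hax : IsAxis (axisDir u (genPair ψ)) := isAxis_normalize h.1 (by simp [axisVec])
  have hcomm (γ : π₁T) : Commute (ψ γ : ℍ[ℝ]) (axisDir u (genPair ψ)) :=
    (((commute_im (commute_values ψ γ mu)).smul_right _).add_right
      ((commute_im (commute_values ψ γ lam)).smul_right _)).smul_right _
  obtain ⟨z, hz, hz'⟩ := exists_circle_axis hax _ (hcomm mu)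
  obtain ⟨w, hw, hw'⟩ := exists_circle_axis hax _ (hcomm lam)
  rw [orbit_eq_rho_of_axis hax hz' hw', circle_eq_exp_arctan hz h.2.1,
    circle_eq_exp_arctan hw h.2.2]
  rfl

theorem isAxis_Ad (g : SU2) : IsAxis ((Ad g ei : su2) : ℍ[ℝ]) := by
  refine ⟨(Ad g ei).2, ?_⟩
  have h := pairing_axis_self g
  have h0 : ((Ad g ei : su2) : ℍ[ℝ]).re = 0 := (Ad g ei).2
  rw [pairing_apply] at h
  simp only [Quaternion.re_mul, h0] at h
  linarith

section Frame

variable {φ : RepSpace π₁T} {g : SU2} {u : ℝ × ℝ}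

theorem IsFrame.eq_axisPt (hf : IsFrame φ g u) (γ : π₁T) : (φ γ : ℍ[ℝ])
    = axisPt (Ad g ei : su2) ⟨Real.cos (angle γ u), Real.sin (angle γ u)⟩ := hf.coe_apply γ

/-- At `φ` the imaginary parts are `sin u.1` and `sin u.2` times the axis. Weighting them by the
same sines gives a positive multiple of the axis, so the vector is nonzero and its sign agrees with
the frame. -/
theorem IsFrame.axisDir_eq (hf : IsFrame φ g u) (hu : IsNoncentral u) :
    axisVec u (genPair φ) ≠ 0 ∧ axisDir u (genPair φ) = ((Ad g ei : su2) : ℍ[ℝ]) := by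
  have him (γ : π₁T) :
      (φ γ : ℍ[ℝ]).im = Real.sin (angle γ u) • ((Ad g ei : su2) : ℍ[ℝ]) := by
    have h0 : ((Ad g ei : su2) : ℍ[ℝ]).re = 0 := (Ad g ei).2
    rw [hf.coe_apply]
    ext <;> simp [h0]
  have hvec : axisVec u (genPair φ)
      = (Real.sin u.1 ^ 2 + Real.sin u.2 ^ 2) • ((Ad g ei : su2) : ℍ[ℝ]) := by
    rw [axisVec, genPair, him, him, angle_mu, angle_lam, smul_smul, smul_smul, ← add_smul, sq, sq]
  have hpos : 0 < Real.sin u.1 ^ 2 + Real.sin u.2 ^ 2 := by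
    rcases hu with h | h <;> positivity
  obtain ⟨h₀, h₁⟩ := isAxis_Ad g
  have hn : ‖((Ad g ei : su2) : ℍ[ℝ])‖ = 1 := by
    have h := Quaternion.normSq_eq_norm_mul_self ((Ad g ei : su2) : ℍ[ℝ])
    rw [Quaternion.normSq_def', h₀] at h
    nlinarith [norm_nonneg ((Ad g ei : su2) : ℍ[ℝ])]
  have hne : ((Ad g ei : su2) : ℍ[ℝ]) ≠ 0 := norm_ne_zero_iff.1 (by rw [hn]; norm_num)
  refine ⟨by rw [hvec]; exact smul_ne_zero hpos.ne' hne, ?_⟩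
  rw [axisDir, hvec, norm_smul, hn, mul_one, Real.norm_of_nonneg hpos.le, smul_smul,
    inv_mul_cancel₀ hpos.ne', one_smul]

theorem IsFrame.relRe_eq (hf : IsFrame φ g u) (γ : π₁T) :
    relRe (angle γ u) (Ad g ei : su2) (φ γ) = 1 := by
  rw [relRe, hf.eq_axisPt, axisProj_axisPt (isAxis_Ad g)]
  linear_combination Real.cos_sq_add_sin_sq (angle γ u)

theorem IsFrame.relIm_eq (hf : IsFrame φ g u) (γ : π₁T) :
    relIm (angle γ u) (Ad g ei : su2) (φ γ) = 0 := by
  rw [relIm, hf.eq_axisPt, axisProj_axisPt (isAxis_Ad g)]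
  ring

theorem IsFrame.mem_locDomain (hf : IsFrame φ g u) (hu : IsNoncentral u) :
    genPair φ ∈ locDomain u := by
  obtain ⟨h₁, h₂⟩ := hf.axisDir_eq hu
  refine ⟨h₁, ?_, ?_⟩
  · have := hf.relRe_eq mu
    rw [angle_mu] at this
    rw [h₂]
    exact this ▸ one_pos
  · have := hf.relRe_eq lam
    rw [angle_lam] at this
    rw [h₂]
    exact this ▸ one_pos

theorem IsFrame.locCoord_eq (hf : IsFrame φ g u) (hu : IsNoncentral u) :
    locCoord u (genPair φ) = u := by
  obtain ⟨h₁, h₂⟩ := hf.axisDir_eq hu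
  have e₁ := hf.relIm_eq mu
  have e₂ := hf.relIm_eq lam
  rw [angle_mu] at e₁
  rw [angle_lam] at e₂
  rw [locCoord, h₂]
  simp only [genPair]
  rw [e₁, e₂, zero_div, zero_div, Real.arctan_zero, add_zero, add_zero]

end Frame

/-! ### Smooth functions -/

theorem coe_eq_smul_one (r : ℝ) : (r : ℍ[ℝ]) = r • (1 : ℍ[ℝ]) := by
  ext <;> simp

theorem contDiff_rho_expPt (γ : π₁T) :
    ContDiff ℝ ∞ fun u : ℝ × ℝ => (rho (expPt u) γ : ℍ[ℝ]) := by
  simp only [coe_rho_expPt, coe_eq_smul_one]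
  have h : ContDiff ℝ ∞ fun u => angle γ u :=
    (LinearMap.toContinuousLinearMap (angle γ)).contDiff
  exact ((Real.contDiff_cos.comp h).smul contDiff_const).add
    ((Real.contDiff_sin.comp h).smul contDiff_const)

theorem continuous_expPt : Continuous expPt := by
  unfold expPt
  fun_prop

/-- One direction composes with the smooth map `u ↦ rho (expPt u)`. For the other, `locCoord` of the
values at `mu` and `lam` recovers the angles, so the pullback of `f` is locally a smooth function of
these two values. -/
theorem smooth_iff_pillow {V : Set (CharVar π₁T)} (hV : V ⊆ topStratum π₁T) (hVo : IsOpen V)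
    (f : CharVar π₁T → ℝ) :
    SmoothFunOn f V ↔ PSmoothFunOn (fun x => f (pillowHomeo x)) (pillowHomeo ⁻¹' V) := by
  constructor
  · intro hf u hu
    refine ContDiffAt.contDiffWithinAt ?_
    obtain ⟨n, γ, F, ⟨W, hW, hF⟩, he⟩ := hf (rho (expPt u)) hu
    have h₁ : ContDiffAt ℝ ∞ F (fun i => (rho (expPt u) (γ i) : ℍ[ℝ])) := hF.contDiffAt hW
    have h₂ : ContDiff ℝ ∞ fun u : ℝ × ℝ => fun i => (rho (expPt u) (γ i) : ℍ[ℝ]) :=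
      contDiff_pi.2 fun i => contDiff_rho_expPt (γ i)
    have h₃ := h₁.comp u h₂.contDiffAt
    refine h₃.congr_of_eventuallyEq ?_
    exact (continuous_rho.comp continuous_expPt).continuousAt.eventually he
  · intro hf φ hφ
    obtain ⟨x, hx⟩ := pillowHomeo.surjective (orbit φ)
    obtain ⟨u, rfl⟩ := exists_coord x
    obtain ⟨g, hg⟩ := exists_frame hx.symm
    have hu : IsNoncentral u := by
      rw [← coord_mem_pillowStar, ← pillowHomeo_mem_topStratum, hx]
      exact hV hφ
    have hO : IsOpen (coord ⁻¹' (pillowHomeo ⁻¹' V)) :=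
      (hVo.preimage pillowHomeo.continuous).preimage continuous_coord
    have hmem := hg.mem_locDomain hu
    have hq : ContDiff ℝ ∞ fun q : Fin 2 → ℍ[ℝ] => (q 0, q 1) := by fun_prop
    refine ⟨2, ![mu, lam], fun q => f (pillowHomeo (coord (locCoord u (q 0, q 1)))),
      ⟨_, ?_, fun q hq => ContDiffAt.contDiffWithinAt hq⟩, ?_⟩
    · have e₁ : ContinuousAt (fun q : Fin 2 → ℍ[ℝ] => (q 0, q 1))
          (fun i => (φ (![mu, lam] i) : ℍ[ℝ])) := hq.continuous.continuousAt
      have e₂ := e₁.eventually (locDomain_mem_nhds hmem)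
      have e₃ : ContinuousAt (fun q : Fin 2 → ℍ[ℝ] => locCoord u (q 0, q 1))
          (fun i => (φ (![mu, lam] i) : ℍ[ℝ])) :=
        ContinuousAt.comp (g := locCoord u) (contDiffAt_locCoord hmem).continuousAt e₁
      have e₄ := e₃.eventually (hO.mem_nhds (by
        change pillowHomeo (coord (locCoord u (genPair φ))) ∈ V
        rw [hg.locCoord_eq hu, hx]
        exact hφ))
      filter_upwards [e₂, e₄] with q h₁ h₂
      have h₃ := hf.contDiffAt (hO.mem_nhds h₂)
      exact h₃.comp q ((contDiffAt_locCoord h₁).comp q hq.contDiffAt)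
    · filter_upwards [continuous_genPair.continuousAt.eventually (locDomain_mem_nhds hmem)]
        with ψ hψ
      rw [orbit_eq_locCoord hψ]
      rfl

/-! ### Velocities -/

theorem exists_Ioo_of_eventually {P : ℝ → Prop} (h : ∀ᶠ s in 𝓝 0, P s) :
    ∃ ε > 0, ∀ s ∈ Set.Ioo (-ε) ε, P s := by
  obtain ⟨ε, hε, hs⟩ := (nhds_basis_Ioo_pos (0 : ℝ)).eventually_iff.1 h
  exact ⟨ε, hε, fun s hs' => hs (by simpa using hs')⟩

theorem eventually_of_Ioo {P : ℝ → Prop} (h : ∃ ε > 0, ∀ s ∈ Set.Ioo (-ε) ε, P s) :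
    ∀ᶠ s in 𝓝 0, P s := by
  obtain ⟨ε, hε, hs⟩ := h
  filter_upwards [Ioo_mem_nhds (neg_lt_zero.2 hε) hε] with s using hs s

/-- Conjugation of a representation. -/
def conjRep (g : SU2) (φ : RepSpace π₁T) : RepSpace π₁T :=
  MonoidHom.comp (MulAut.conj g).toMonoidHom φ

theorem isFrame_conjRep (g : SU2) (u : ℝ × ℝ) : IsFrame (conjRep g (rho (expPt u))) g u :=
  fun _ => rfl

section Frame

variable {φ : RepSpace π₁T} {g : SU2} {u : ℝ × ℝ}

theorem IsFrame.eq_conjRep (hf : IsFrame φ g u) : conjRep g (rho (expPt u)) = φ :=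
  DFunLike.ext _ _ fun γ => (hf γ).symm

/-- Applying `locCoord` to a smooth lift of the curve gives a smooth curve of angles through `u`. -/
theorem exists_pHasVelocity (hf : IsFrame φ g u) (hu : IsNoncentral u) {κ : ℝ → CharVar π₁T}
    {h : H1 φ} (hκ : HasVelocity κ φ h) :
    ∃ v, PHasVelocity (fun s => pillowHomeo.symm (κ s)) u v := by
  obtain ⟨σ, h0, h₁, ⟨ε, hε, h₂⟩, -⟩ := hκ
  have hI : Set.Ioo (-ε) ε ∈ 𝓝 (0 : ℝ) := Ioo_mem_nhds (neg_lt_zero.2 hε) hε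
  have hσ (s : ℝ) (hs : s ∈ Set.Ioo (-ε) ε) : ContDiffAt ℝ ∞ (fun s => genPair (σ s)) s :=
    ((h₂ mu).contDiffAt (isOpen_Ioo.mem_nhds hs)).prodMk
      ((h₂ lam).contDiffAt (isOpen_Ioo.mem_nhds hs))
  have hmem := hf.mem_locDomain hu
  have h0' : (0 : ℝ) ∈ Set.Ioo (-ε) ε := ⟨neg_lt_zero.2 hε, hε⟩
  have hdom : ∀ᶠ s in 𝓝 (0 : ℝ), genPair (σ s) ∈ locDomain u := by
    refine (hσ 0 h0').continuousAt.eventually (locDomain_mem_nhds ?_)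
    change genPair (σ 0) ∈ locDomain u
    rw [h0]
    exact hmem
  have hc : ∀ᶠ s in 𝓝 (0 : ℝ), ContDiffAt ℝ ∞ (fun s => locCoord u (genPair (σ s))) s := by
    filter_upwards [hdom, hI] with s hs hs'
    exact (contDiffAt_locCoord hs).comp s (hσ s hs')
  refine ⟨_, fun s => locCoord u (genPair (σ s)), ?_, ?_, ?_,
    (hc.self_of_nhds.differentiableAt (by simp)).hasDerivAt⟩
  · change locCoord u (genPair (σ 0)) = u
    rw [h0, hf.locCoord_eq hu]
  · refine exists_Ioo_of_eventually ?_
    filter_upwards [hdom, eventually_of_Ioo h₁] with s hs hs'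
    rw [← hs', orbit_eq_locCoord hs, pillowHomeo.symm_apply_apply]
  · obtain ⟨δ, hδ, h⟩ := exists_Ioo_of_eventually hc
    exact ⟨δ, hδ, fun s hs => (h s hs).contDiffWithinAt⟩

theorem character_coord (γ : π₁T) (u : ℝ × ℝ) :
    character γ (pillowHomeo (coord u)) = Real.cos (angle γ u) := by
  change (rho (expPt u) γ : ℍ[ℝ]).re = _
  rw [coe_rho_expPt]
  simp

theorem hasDerivAt_angle {c : ℝ → ℝ × ℝ} {v : ℝ × ℝ} (hc : HasDerivAt c v 0) (γ : π₁T) :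
    HasDerivAt (fun s => angle γ (c s)) (angle γ v) 0 :=
  (LinearMap.toContinuousLinearMap (angle γ)).hasFDerivAt.comp_hasDerivAt 0 hc

theorem IsFrame.re_mul (hf : IsFrame φ g u) (z : Z1 φ) (γ : π₁T) :
    ((z.1 γ : ℍ[ℝ]) * (φ γ : ℍ[ℝ])).re = -Real.sin (angle γ u) * axisComp g z γ := by
  have h0 : (z.1 γ : ℍ[ℝ]).re = 0 := (z.1 γ).2
  have h1 : ((Ad g ei : su2) : ℍ[ℝ]).re = 0 := (Ad g ei).2
  rw [hf.coe_apply, axisComp, pairing_apply]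
  simp [h0, h1]
  ring

/-- Where one sine vanishes, that generator's equation says nothing about its unknown. The equation
for `mu * lam` replaces it, because `sin (u.1 + u.2)` is then the other sine times a nonzero cosine.
-/
theorem eq_of_sin_mul {d₁ d₂ : ℝ} (hu : IsNoncentral u) (h₁ : Real.sin u.1 * d₁ = 0)
    (h₂ : Real.sin u.2 * d₂ = 0) (h₃ : Real.sin (u.1 + u.2) * (d₁ + d₂) = 0) :
    d₁ = 0 ∧ d₂ = 0 := by
  rw [Real.sin_add] at h₃
  have hcos (x : ℝ) (hx : Real.sin x = 0) : Real.cos x ≠ 0 := fun h => by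
    have := Real.sin_sq_add_cos_sq x
    rw [hx, h] at this
    norm_num at this
  by_cases k₁ : Real.sin u.1 = 0
  · have k₂ : Real.sin u.2 ≠ 0 := hu.resolve_left (not_not.2 k₁)
    have e₂ := (mul_eq_zero.1 h₂).resolve_left k₂
    rw [k₁, e₂, zero_mul, zero_add, add_zero] at h₃
    exact ⟨(mul_eq_zero.1 h₃).resolve_left (mul_ne_zero (hcos _ k₁) k₂), e₂⟩
  · have e₁ := (mul_eq_zero.1 h₁).resolve_left k₁
    refine ⟨e₁, ?_⟩
    by_cases k₂ : Real.sin u.2 = 0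
    · rw [k₂, e₁, mul_zero, add_zero, zero_add] at h₃
      exact (mul_eq_zero.1 h₃).resolve_left (mul_ne_zero k₁ (hcos _ k₂))
    · exact (mul_eq_zero.1 h₂).resolve_left k₂

theorem axis_mul_self (g : SU2) :
    ((Ad g ei : su2) : ℍ[ℝ]) * ((Ad g ei : su2) : ℍ[ℝ]) = -1 := by
  obtain ⟨h₀, h₁⟩ := isAxis_Ad g
  ext <;> simp [h₀] <;> linarith

/-- Lifts of a curve are not unique, but characters do not see the lift: their derivatives fix the
axis component of the cocycle, hence its class. Conversely, conjugating `rho` of the angle curve by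
the fixed `g` is a lift whose cocycle is `axisCocycle`. -/
theorem hasVelocity_iff (hf : IsFrame φ g u) (hu : IsNoncentral u) {κ : ℝ → Pillowcase}
    {v : ℝ × ℝ} (hκ : PHasVelocity κ u v) (h : H1 φ) :
    HasVelocity (fun s => pillowHomeo (κ s)) φ h ↔ h = tangentEquiv hf hu v := by
  obtain ⟨c, hc0, hcκ, ⟨ε, hε, hcs⟩, hcd⟩ := hκ
  constructor
  · rintro ⟨σ, -, h₁, -, z, rfl, hz⟩
    -- The derivative at `0` of the real part of `σ s γ` is computed twice: from the cocycle, and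
    -- from the cosine of the angle.
    have key (γ : π₁T) : Real.sin (angle γ u) * (axisComp g z γ - angle γ v) = 0 := by
      have d₁ : HasDerivAt (fun s => (σ s γ : ℍ[ℝ]).re)
          ((z.1 γ : ℍ[ℝ]) * (φ γ : ℍ[ℝ])).re 0 :=
        (LinearMap.toContinuousLinearMap
          ({ toFun := fun q => q.re, map_add' := by simp, map_smul' := by simp } :
            ℍ[ℝ] →ₗ[ℝ] ℝ)).hasFDerivAt.comp_hasDerivAt 0 (hz γ)
      have d₂ := (hasDerivAt_angle hcd γ).cos
      have e : (fun s => (σ s γ : ℍ[ℝ]).re) =ᶠ[𝓝 0] fun s => Real.cos (angle γ (c s)) := by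
        filter_upwards [eventually_of_Ioo h₁, eventually_of_Ioo hcκ] with s hs hs'
        rw [← character_orbit, hs, ← hs', character_coord]
      have d₃ := d₁.unique (d₂.congr_of_eventuallyEq e)
      rw [hf.re_mul, hc0] at d₃
      linarith
    have k₁ := key mu
    have k₂ := key lam
    have k₃ := key (mu * lam)
    rw [axisComp_mul hf, angle_mul, angle_mul] at k₃
    rw [angle_mu, angle_mu] at k₁ k₃
    rw [angle_lam, angle_lam] at k₂ k₃
    obtain ⟨e₁, e₂⟩ := eq_of_sin_mul hu k₁ k₂ (by linear_combination k₃)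
    exact cls_eq_of_axisComp hf hu z v (sub_eq_zero.1 e₁) (sub_eq_zero.1 e₂)
  · rintro rfl
    have hσ (s : ℝ) := isFrame_conjRep g (c s)
    refine ⟨fun s => conjRep g (rho (expPt (c s))), ?_, ?_, ⟨ε, hε, fun γ => ?_⟩,
      axisCocycle hf v, rfl, fun γ => ?_⟩
    · change conjRep g (rho (expPt (c 0))) = φ
      rw [hc0]
      exact hf.eq_conjRep
    · refine exists_Ioo_of_eventually ?_
      filter_upwards [eventually_of_Ioo hcκ] with s hs
      rw [← hs]
      exact orbit_of_frame (hσ s)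
    · have h₁ := (contDiff_rho_expPt γ).comp_contDiffOn hcs
      exact (contDiffOn_const.mul h₁).mul contDiffOn_const
    · have e (s : ℝ) := (hσ s).coe_apply γ
      simp only [e, coe_eq_smul_one]
      have d := hasDerivAt_angle hcd γ
      have d' := (d.cos.smul_const (1 : ℍ[ℝ])).add
        (d.sin.smul_const ((Ad g ei : su2) : ℍ[ℝ]))
      refine d'.congr_deriv ?_
      rw [hc0, axisCocycle_apply, hf.coe_apply, coe_eq_smul_one]
      change _ = (angle γ v • ((Ad g ei : su2) : ℍ[ℝ])) * _
      -- With `h` the axis, `h² = -1` turns `h (cos + sin h)` into `-sin + cos h`, the derivative of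
      -- `cos + sin h`.
      rw [mul_add, smul_mul_smul_comm, smul_mul_smul_comm, axis_mul_self, mul_one, smul_neg,
        ← neg_smul, add_comm]
      congr 1
      · rw [mul_comm]
      · congr 1
        ring

end Frame

theorem isSymplectoFromPillowcase : IsSymplectoFromPillowcase 1 pillowHomeo where
  image_eq := image_pillowStar
  smooth_iff _ hV hVo f := smooth_iff_pillow hV hVo f
  pullback_form u hu φ hφ := by
    obtain ⟨g, hg⟩ := exists_frame hφ
    have hu' := (coord_mem_pillowStar u).1 hu
    refine ⟨tangentEquiv hg hu', fun κ v hκ h => hasVelocity_iff hg hu' hκ h, fun v w => ?_⟩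
    rw [omega_tangentEquiv, one_mul]

/-! ### The action is symplectic -/

/-- The linear map on angles induced by a matrix. -/
def angleMap (A : SL2Z) : (ℝ × ℝ) →ₗ[ℝ] (ℝ × ℝ) where
  toFun u := (A.1 0 0 * u.1 + A.1 0 1 * u.2, A.1 1 0 * u.1 + A.1 1 1 * u.2)
  map_add' u v := by
    ext <;> simp <;> ring
  map_smul' c u := by
    ext <;> simp <;> ring

theorem angleMap_apply (A : SL2Z) (u : ℝ × ℝ) :
    angleMap A u = (A.1 0 0 * u.1 + A.1 0 1 * u.2, A.1 1 0 * u.1 + A.1 1 1 * u.2) := rfl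

theorem det_cast (A : SL2Z) : (A.1 0 0 : ℝ) * A.1 1 1 - A.1 0 1 * A.1 1 0 = 1 := by
  have h := A.2
  rw [Matrix.det_fin_two] at h
  exact_mod_cast h

theorem coord_angleMap (A : SL2Z) (u : ℝ × ℝ) : coord (angleMap A u) = A • coord u := by
  rw [coord_eq, coord_eq, smul_proj]
  congr 1
  simp [expPt, slAct, angleMap_apply, Circle.exp_add]

/-- The linear automorphism of the angles induced by a matrix. -/
def angleEquiv (A : SL2Z) : (ℝ × ℝ) ≃ₗ[ℝ] (ℝ × ℝ) :=
  { angleMap A with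
    invFun := fun u => (A.1 1 1 * u.1 - A.1 0 1 * u.2, -A.1 1 0 * u.1 + A.1 0 0 * u.2)
    left_inv := fun u => by
      have h := det_cast A
      ext
      · simp [angleMap_apply]
        linear_combination u.1 * h
      · simp [angleMap_apply]
        linear_combination u.2 * h
    right_inv := fun u => by
      have h := det_cast A
      ext
      · simp [angleMap_apply]
        linear_combination u.1 * h
      · simp [angleMap_apply]
        linear_combination u.2 * h }

theorem angleEquiv_apply (A : SL2Z) (u : ℝ × ℝ) : angleEquiv A u = angleMap A u := rfl

theorem contDiff_angleMap (A : SL2Z) : ContDiff ℝ ∞ (angleMap A) :=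
  (LinearMap.toContinuousLinearMap (angleMap A)).contDiff

theorem smul_mem_pillowStar (A : SL2Z) {x : Pillowcase} (hx : x ∈ pillowStar) :
    A • x ∈ pillowStar := by
  obtain ⟨t, ht, rfl⟩ := hx
  rw [smul_proj, mem_pillowStar_proj]
  intro h
  refine ht ?_
  rw [← slAct_inv] at h
  have h' := congrArg (slAct A⁻¹) h
  rwa [← slAct_mul, ← slAct_mul, inv_mul_cancel, slAct_one, slAct_one] at h'

theorem charAction_mem_topStratum (g : PSL2Z) {x : CharVar π₁T} (hx : x ∈ topStratum π₁T) :
    charAction g x ∈ topStratum π₁T := by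
  obtain ⟨y, rfl⟩ := pillowHomeo.surjective x
  rw [charAction_pillowHomeo]
  rw [pillowHomeo_mem_topStratum] at hx ⊢
  induction g using QuotientGroup.induction_on with
  | H A => exact smul_mem_pillowStar A hx

theorem charAction_inv_apply (g : PSL2Z) (x : CharVar π₁T) :
    charAction g (charAction g⁻¹ x) = x := by
  have h : charAction g * charAction g⁻¹ = 1 := by rw [← map_mul, mul_inv_cancel, map_one]
  exact congrArg (fun f : CharVar π₁T ≃ₜ CharVar π₁T => f x) h

theorem preimage_subset_topStratum (g : PSL2Z) {V : Set (CharVar π₁T)}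
    (hV : V ⊆ topStratum π₁T) : charAction g ⁻¹' V ⊆ topStratum π₁T := fun x hx => by
  have h := charAction_mem_topStratum g⁻¹ (hV hx)
  have e := charAction_inv_apply g⁻¹ x
  rw [inv_inv] at e
  rwa [e] at h

/-- In the angle coordinates the action of a matrix is a linear map, hence smooth. -/
theorem smooth_charAction (g : PSL2Z) {V : Set (CharVar π₁T)} (hV : V ⊆ topStratum π₁T)
    (hVo : IsOpen V) {f : CharVar π₁T → ℝ} (hf : SmoothFunOn f V) :
    SmoothFunOn (fun x => f (charAction g x)) (charAction g ⁻¹' V) := by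
  have hV' := preimage_subset_topStratum g hV
  rw [smooth_iff_pillow hV hVo] at hf
  rw [smooth_iff_pillow hV' (hVo.preimage (charAction g).continuous)]
  induction g using QuotientGroup.induction_on with
  | H A =>
    have e (u : ℝ × ℝ) : charAction (QuotientGroup.mk A) (pillowHomeo (coord u))
        = pillowHomeo (coord (angleMap A u)) := by
      rw [charAction_pillowHomeo, coord_angleMap]
      rfl
    have h := hf.comp (contDiff_angleMap A).contDiffOn
      (Set.mapsTo_preimage (angleMap A) (coord ⁻¹' (pillowHomeo ⁻¹' V)))
    refine (h.congr fun u _ => congrArg f (e u)).mono fun u hu => ?_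
    change pillowHomeo (coord (angleMap A u)) ∈ V
    rw [← e]
    exact hu

theorem isSymplectoOfCharVar_charAction (g : PSL2Z) : IsSymplectoOfCharVar (charAction g) where
  image_eq := by
    refine Set.Subset.antisymm ?_ fun x hx => ?_
    · rintro _ ⟨x, hx, rfl⟩
      exact charAction_mem_topStratum g hx
    · exact ⟨charAction g⁻¹ x, charAction_mem_topStratum g⁻¹ hx, charAction_inv_apply g x⟩
  smooth_iff V hV hVo f := by
    refine ⟨smooth_charAction g hV hVo, fun h => ?_⟩
    have hV' := preimage_subset_topStratum g hV
    have h' := smooth_charAction g⁻¹ hV' (hVo.preimage (charAction g).continuous) h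
    rw [← Set.preimage_comp] at h'
    have e : (charAction g : CharVar π₁T → CharVar π₁T) ∘ charAction g⁻¹ = id :=
      funext (charAction_inv_apply g)
    simpa only [charAction_inv_apply, e, Set.preimage_id] using h'
  preserves_form φ φ' hφ hφ' := by
    induction g using QuotientGroup.induction_on with
    | H A =>
      obtain ⟨x, hx⟩ := pillowHomeo.surjective (orbit φ)
      obtain ⟨u, rfl⟩ := exists_coord x
      rw [← hx, pillowHomeo_mem_topStratum] at hφ
      have hu := (coord_mem_pillowStar u).1 hφ
      have hAu : IsNoncentral (angleMap A u) := by
        rw [← coord_mem_pillowStar, coord_angleMap]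
        exact smul_mem_pillowStar A hφ
      obtain ⟨k, hk⟩ := exists_frame hx.symm
      have hφ'' : orbit φ' = pillowHomeo (coord (angleMap A u)) := by
        rw [hφ', ← hx, charAction_pillowHomeo, coord_angleMap]
        rfl
      obtain ⟨k', hk'⟩ := exists_frame hφ''
      -- In angle coordinates the differential is the matrix `A` itself. Either lift of `g` to
      -- `SL(2, ℤ)` serves, since the frame `k'` of `φ'` is chosen for the angles `angleMap A u`.
      refine ⟨((tangentEquiv hk hu).symm.trans (angleEquiv A)).trans (tangentEquiv hk' hAu),
        fun κ h hκ h' => ?_, fun h h' => ?_⟩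
      · obtain ⟨v, hv⟩ := exists_pHasVelocity hk hu hκ
        have e : h = tangentEquiv hk hu v := by
          rw [← hasVelocity_iff hk hu hv]
          simpa only [pillowHomeo.apply_symm_apply] using hκ
        have hv' : PHasVelocity (fun s => A • pillowHomeo.symm (κ s)) (angleMap A u)
            (angleMap A v) := by
          obtain ⟨c, hc0, hcκ, ⟨ε, hε, hcs⟩, hcd⟩ := hv
          refine ⟨fun s => angleMap A (c s), congrArg (angleMap A) hc0, ?_, ⟨ε, hε, ?_⟩, ?_⟩
          · obtain ⟨δ, hδ, hs⟩ := hcκ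
            exact ⟨δ, hδ, fun s hs' => by rw [coord_angleMap, hs s hs']⟩
          · exact (contDiff_angleMap A).comp_contDiffOn hcs
          · exact (LinearMap.toContinuousLinearMap (angleMap A)).hasFDerivAt.comp_hasDerivAt 0 hcd
        have e' := hasVelocity_iff hk' hAu hv' h'
        have e'' : (fun s => pillowHomeo (A • pillowHomeo.symm (κ s)))
            = fun s => charAction (QuotientGroup.mk A) (κ s) := rfl
        rw [e''] at e'
        rw [e', e]
        simp [angleEquiv_apply]
      · obtain ⟨v, rfl⟩ := (tangentEquiv hk hu).surjective h
        obtain ⟨w, rfl⟩ := (tangentEquiv hk hu).surjective h'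
        simp only [LinearEquiv.trans_apply, LinearEquiv.symm_apply_apply, omega_tangentEquiv,
          angleEquiv_apply, angleMap_apply]
        -- A linear map of the plane scales `dx ∧ dy` by its determinant, here `1`.
        linear_combination (v.1 * w.2 - v.2 * w.1) * det_cast A

end Pillow

end

theorem mainTheorem8 :
    -- the action of `PSL(2, ℤ)` on `χ(T)` defined by the Dehn twists
    ∃ a : Pillow.PSL2Z →* (Pillow.CharVar Pillow.π₁T ≃ₜ Pillow.CharVar Pillow.π₁T),
      (∀ b : Pillow.PSL2Z →* (Pillow.CharVar Pillow.π₁T ≃ₜ Pillow.CharVar Pillow.π₁T),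
        ((∀ x, b Pillow.matMu x = Pillow.pullback Pillow.dehnMuHom x) ∧
          (∀ x, b Pillow.matLam x = Pillow.pullback Pillow.dehnLamHom x)) ↔ b = a) ∧
      Function.Injective a ∧
      a.range = Subgroup.closure {a Pillow.matMu, a Pillow.matLam} ∧
      (∀ g, Pillow.IsSymplectoOfCharVar (a g)) ∧
      Pillow.PreservesFormalForm Pillow.dehnMuHom ∧
      Pillow.PreservesFormalForm Pillow.dehnLamHom ∧
      -- the map `ρ : 𝕋 → Hom(π₁(T), SU(2))`
      ∃ ρ : Pillow.UTorus → Pillow.RepSpace Pillow.π₁T,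
        (∀ t φ, φ = ρ t ↔
          φ Pillow.mu = Pillow.circleToSU2 t.1 ∧ φ Pillow.lam = Pillow.circleToSU2 t.2) ∧
        -- descends to an equivariant homeomorphism which is a symplectomorphism on top strata
        ∃ Φ : Pillow.Pillowcase ≃ₜ Pillow.CharVar Pillow.π₁T,
          (∀ t, Φ (Pillow.proj t) = Pillow.orbit (ρ t)) ∧
          (∀ (g : Pillow.PSL2Z) (x : Pillow.Pillowcase), Φ (g • x) = a g (Φ x)) ∧
          ∃ c : ℝ, c ≠ 0 ∧ Pillow.IsSymplectoFromPillowcase c Φ := by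
  refine ⟨Pillow.charAction, Pillow.eq_charAction_iff, Pillow.charAction_injective,
    Pillow.range_charAction, Pillow.isSymplectoOfCharVar_charAction,
    Pillow.preservesFormalForm_dehnMu, Pillow.preservesFormalForm_dehnLam, Pillow.rho,
    fun t φ => Pillow.eq_rho_iff t φ, Pillow.pillowHomeo, Pillow.pillowHomeo_proj,
    fun g x => (Pillow.charAction_pillowHomeo g x).symm, 1, one_ne_zero,
    Pillow.isSymplectoFromPillowcase⟩
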